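/- Let $g,\kappa,L>0$ and let $H_0,V_0>0$ satisfy $$V_0^2<gH_0<(2+\sqrt2)\,V_0^2 .$$ Let $b_0,b_1,c_1\in\mathbb R$. For $\mu>0$ put $f(H,V)=\dfrac{\kappa V}{1+\kappa H/(3\mu)}$. Then there is $\mu_\circ>0$ such that the following holds for every $\mu\in(0,\mu_\circ)$ and every steady state $(H^*,V^*)\in C^2([0,L];(0,\infty))^2$ of the viscous Saint-Venant equations, i.e. every positive solution of $$(H^*V^*)_x=0,\qquad V^*V^*_x+gH^*_x+\frac{f(H^*,V^*)}{H^*}-4\mu\frac{(H^*V^*_x)_x}{H^*}=0\quad\text{on }[0,L],$$ with $gH^*>V^{*2}$ on $[0,L]$, $H^*(0)=H_0$, $V^*(0)=V_0$ and $V^*_x(0)=0$. Consider the linearized system for $y=(h,v)^T$, $$Ay_{xx}+y_t+B(x)y_x+C(x)y=0,\tag{1}$$ $$A=\begin{pmatrix}0&0\\0&-4\mu\end{pmatrix},\qquad B=\begin{pmatrix}V^*&H^*\\ g-4\mu\frac{V^*_x}{H^*}&V^*-4\mu\frac{H^*_x}{H^*}\end{pmatrix},$$ $$C=\begin{pmatrix}V^*_x&H^*_x\\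 \frac{4\mu H^*_xV^*_x-f(H^*,V^*)}{H^{*2}}-\frac{f(H^*,V^*)^2}{3\mu H^*V^*}&V^*_x+\frac{f(H^*,V^*)}{H^*V^*}\end{pmatrix},$$ with boundary conditions $$v(t,0)=-b_0h(t,0),\qquad v(t,L)=b_1h(t,L)+\mu c_1v_x(t,L),\qquad v_x(t,0)=0.\tag{2}$$ Let $Q=\operatorname{diag}(g+\mu\tilde q_1,\;H^*+\mu\tilde q_2)$ with $\tilde q_2=H^*$ and $\tilde q_1=g-4(1+\mu)\frac{V^*_x}{H^*}$ (a choice for which $QB$ is symmetric), and let $$W(y)=\int_0^L y(x)^TQ(x)y(x)\,dx,\qquad y\in L^2((0,L);\mathbb R^2).$$ 1. There are constants $k_1,k_2>0$ such that $k_1\|y\|_{L^2}^2\le W(y)\le k_2\|y\|_{L^2}^2$ for all $y\in L^2((0,L);\mathbb R^2)$. In particular $W(y)>0$ for $y\ne0$, $W(0)=0$, and $W(y)\to+\infty$ as $\|y\|_{L^2}\to+\infty$. 2. Suppose that $b_0\in(b_0^-,b_0^+)$, $b_1\in\mathbb R\setminus[b_1^-,b_1^+]$ and $c_1\in(c_1^-,c_1^+)$,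 where $$b_0^\pm=g\left(\frac1{V^*(0)}\pm\sqrt{\frac1{V^*(0)^2}-\frac1{gH^*(0)}}\right),\qquad b_1^\pm=g\left(-\frac1{V^*(L)}\pm\sqrt{\frac1{V^*(L)^2}-\frac1{gH^*(L)}}\right),$$ $$c_1^\pm=\left.\frac{4\left(-V^*-b_1H^*\pm\sqrt{V^*\left(H^*V^*b_1^2/g+2H^*b_1+V^*\right)}\right)}{gH^*-V^{*2}}\right|_{x=L}.$$ Then there is $\gamma>0$ such that for every solution $y\in C^1([0,\infty);L^2((0,L);\mathbb R^2))$ of (1), (2) (with $h(t,\cdot)\in H^1(0,L)$ and $v(t,\cdot)\in H^2(0,L)$ for each $t\ge 0$, equation (1) holding in $L^2$ and (2) in the sense of traces), the function $t\mapsto W(y(t,\cdot))$ is differentiable on $[0,\infty)$ and $$\frac{d}{dt}W(y(t,\cdot))\le-\gamma\,W(y(t,\cdot))\qquad\text{for all }t\ge0 .$$ -/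

import Mathlib

open MeasureTheory Matrix

noncomputable section

namespace ViscousSaintVenant

/-- Space derivative of a function on `[0, L]` (one-sided at the end points). -/
def dx (L : ℝ) (u : ℝ → ℝ) : ℝ → ℝ := derivWithin u (Set.Icc 0 L)

/-- The modified friction term `f(H, V)`. -/
def friction (κ μ H V : ℝ) : ℝ := κ * V / (1 + κ * H / (3 * μ))

/-- `(H, V)` is a positive, subcritical, `C²` time-independent solution on `[0, L]` of the viscous
Saint-Venant equations, with `V_x(0) = 0` and with data `H(0) = H₀`, `V(0) = V₀`. -/
structure IsSteadyState (g κ μ L H₀ V₀ : ℝ) (H V : ℝ → ℝ) : Prop where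
  contDiff_H : ContDiffOn ℝ 2 H (Set.Icc 0 L)
  contDiff_V : ContDiffOn ℝ 2 V (Set.Icc 0 L)
  pos_H : ∀ x ∈ Set.Icc 0 L, 0 < H x
  pos_V : ∀ x ∈ Set.Icc 0 L, 0 < V x
  mass : ∀ x ∈ Set.Icc 0 L, dx L (fun s => H s * V s) x = 0
  momentum : ∀ x ∈ Set.Icc 0 L,
    V x * dx L V x + g * dx L H x + friction κ μ (H x) (V x) / H x
      - 4 * μ * (dx L (fun s => H s * dx L V s) x / H x) = 0
  subcritical : ∀ x ∈ Set.Icc 0 L, V x ^ 2 < g * H x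
  H_zero : H 0 = H₀
  V_zero : V 0 = V₀
  dx_V_zero : dx L V 0 = 0

/-! ### The linearized system -/

/-- The matrix `A`. -/
def matA (μ : ℝ) : Matrix (Fin 2) (Fin 2) ℝ := !![0, 0; 0, -4 * μ]

/-- The matrix `B(x)`. -/
def matB (g μ L : ℝ) (H V : ℝ → ℝ) (x : ℝ) : Matrix (Fin 2) (Fin 2) ℝ :=
  !![V x, H x;
     g - 4 * μ * (dx L V x / H x), V x - 4 * μ * (dx L H x / H x)]

/-- The matrix `C(x)`. -/
def matC (κ μ L : ℝ) (H V : ℝ → ℝ) (x : ℝ) : Matrix (Fin 2) (Fin 2) ℝ :=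
  !![dx L V x, dx L H x;
     (4 * μ * dx L H x * dx L V x - friction κ μ (H x) (V x)) / H x ^ 2
        - friction κ μ (H x) (V x) ^ 2 / (3 * μ * H x * V x),
     dx L V x + friction κ μ (H x) (V x) / (H x * V x)]

/-- The space `L²((0, L); ℝ²)`. -/
abbrev L2 (L : ℝ) : Type :=
  Lp (EuclideanSpace ℝ (Fin 2)) 2 (volume.restrict (Set.Ioo (0 : ℝ) L))

/-- `u` is (on `[0, L]`) the continuous representative of a function of `H¹(0, L)` whose weak
derivative is `u'`: it is a primitive of the square integrable function `u'`. -/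
def HasH1Deriv (L : ℝ) (u u' : ℝ → ℝ) : Prop :=
  MemLp u' 2 (volume.restrict (Set.Ioo (0 : ℝ) L)) ∧
    ∀ x ∈ Set.Icc 0 L, u x = u 0 + ∫ s in (0 : ℝ)..x, u' s

/-- `y = (h, v) ∈ C¹([0, ∞); L²((0, L); ℝ²))` is a solution of the linearized system
`A y_xx + y_t + B y_x + C y = 0` with the linearized boundary conditions. At each time
`h ∈ H¹(0, L)` and `v ∈ H²(0, L)`; the first column of `A` vanishes, so that no second space
derivative of `h` occurs in the system (hence the entry `0` below). -/
structure IsSolution (g κ μ L b₀ b₁ c₁ : ℝ) (H V : ℝ → ℝ) (y : ℝ → L2 L) : Prop where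
  contDiff : ContDiffOn ℝ 1 y (Set.Ici 0)
  eqn : ∀ t : ℝ, 0 ≤ t → ∃ h hx v vx vxx : ℝ → ℝ,
    HasH1Deriv L h hx ∧ HasH1Deriv L v vx ∧ HasH1Deriv L vx vxx ∧
    (∀ᵐ x ∂(volume.restrict (Set.Ioo (0 : ℝ) L)), (y t x).ofLp = ![h x, v x]) ∧
    (∀ᵐ x ∂(volume.restrict (Set.Ioo (0 : ℝ) L)),
      matA μ *ᵥ ![0, vxx x] + (derivWithin y (Set.Ici 0) t x).ofLp
        + matB g μ L H V x *ᵥ ![hx x, vx x] + matC κ μ L H V x *ᵥ ![h x, v x] = 0) ∧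
    v 0 = -b₀ * h 0 ∧
    v L = b₁ * h L + μ * c₁ * vx L ∧
    vx 0 = 0

/-! ### The Lyapunov function -/

/-- The correction `q̃₁`. -/
def qTilde₁ (g μ L : ℝ) (H V : ℝ → ℝ) (x : ℝ) : ℝ := g - 4 * (1 + μ) * (dx L V x / H x)

/-- The correction `q̃₂`. -/
def qTilde₂ (H : ℝ → ℝ) (x : ℝ) : ℝ := H x

/-- The diagonal weight `Q(x)`. -/
def matQ (g μ L : ℝ) (H V : ℝ → ℝ) (x : ℝ) : Matrix (Fin 2) (Fin 2) ℝ :=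
  Matrix.diagonal ![g + μ * qTilde₁ g μ L H V x, H x + μ * qTilde₂ H x]

/-- With this choice of `q̃₁` and `q̃₂`, the matrix `Q B` is symmetric. -/
theorem matQ_mul_matB_isSymm (g μ L : ℝ) (H V : ℝ → ℝ) (x : ℝ) (hx : H x ≠ 0) :
    (matQ g μ L H V x * matB g μ L H V x).IsSymm := by
  ext i j
  fin_cases i <;> fin_cases j <;>
    simp [matQ, matB, qTilde₁, qTilde₂, Matrix.diagonal_mul] <;> field_simp <;> ring

/-- The Lyapunov function `W(y) = ∫₀ᴸ yᵀ Q y dx` on `L²((0, L); ℝ²)`. -/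
def lyapunov (g μ L : ℝ) (H V : ℝ → ℝ) (y : L2 L) : ℝ :=
  ∫ x in Set.Ioo (0 : ℝ) L, (y x).ofLp ⬝ᵥ (matQ g μ L H V x *ᵥ (y x).ofLp)

/-! ### The conditions on the boundary coefficients -/

/-- The conditions `b₀ ∈ (b₀⁻, b₀⁺)`, `b₁ ∈ ℝ \ [b₁⁻, b₁⁺]`, `c₁ ∈ (c₁⁻, c₁⁺)`. -/
structure BoundaryCondition (g L b₀ b₁ c₁ : ℝ) (H V : ℝ → ℝ) : Prop where
  hb₀ : b₀ ∈ Set.Ioo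
    (g * (1 / V 0 - √(1 / V 0 ^ 2 - 1 / (g * H 0))))
    (g * (1 / V 0 + √(1 / V 0 ^ 2 - 1 / (g * H 0))))
  hb₁ : b₁ ∉ Set.Icc
    (g * (-(1 / V L) - √(1 / V L ^ 2 - 1 / (g * H L))))
    (g * (-(1 / V L) + √(1 / V L ^ 2 - 1 / (g * H L))))
  hc₁ : c₁ ∈ Set.Ioo
    (4 * (-V L - b₁ * H L - √(V L * (H L * V L * b₁ ^ 2 / g + 2 * H L * b₁ + V L)))
      / (H L * g - V L ^ 2))
    (4 * (-V L - b₁ * H L + √(V L * (H L * V L * b₁ ^ 2 / g + 2 * H L * b₁ + V L)))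
      / (H L * g - V L ^ 2))

end ViscousSaintVenant

end

noncomputable section

namespace ViscousSaintVenant

/-! Write `w = H V_x`, `a = gH/V - V > 0` and `f` for the friction. With mass conservation the
momentum equation becomes `4μ w' = f - a w`, `w(0) = 0`. A minimum principle gives `w ≥ 0` and then
`a w ≤ f`. So `V` is nondecreasing and `H` nonincreasing; since `f = O(μ)`, also `w = O(μ)` and `V`
stays close to `V₀` (`IsSteadyState.V_le`).

The weight is `Q = (1 + μ) diag(p, H)` with `p` the function `weight`, and `g - p = O(μ²)`. Testing
the linearized system with `(p h, H v)` gives `dW/dt` as `1 + μ` times a flux difference, plus the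
integral of `interiorForm`, minus `8μ ∫ H v_x²` (`IsSteadyState.energy_inequality`).

With `F = f + V w`, the interior form is at most `-(V F/H²) h² + 2 k h v - (2F/V) v²`, where `|k| ≤
(a w + f)/H`. It is negative definite if `a w + f < √2 F`. Since `a w ≤ f` and `a ≤ r V` with `r =
gH₀/V₀² - 1`, the worst case is `a w = f`, `a = r V`, and there the condition is `r < 1 + √2`, that
is `gH₀ < (2 + √2) V₀²`. As `f` is at least a constant times `μ`, the decay rate has order `μ`.

At the inflow `p = g` and `v_x = 0`, and the condition on `b₀` fixes the sign of the flux. At the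
outflow the condition on `c₁` gives the sign with `g` in place of `p`. The `O(μ²)` error is absorbed
by a trace term of order `μ`, obtained by adding `e μ x v²` to the flux at the expense of half the
interior decay and the viscous dissipation. -/

/-- The horizontal stress `H V_x` of a steady state. -/
def stress (L : ℝ) (H V : ℝ → ℝ) (x : ℝ) : ℝ := H x * dx L V x

theorem hasDerivWithinAt_dx {L : ℝ} {u : ℝ → ℝ} {n : WithTop ℕ∞}
    (hu : ContDiffOn ℝ n u (Set.Icc 0 L)) (hn : n ≠ 0) {x : ℝ} (hx : x ∈ Set.Icc 0 L) :
    HasDerivWithinAt u (dx L u x) (Set.Icc 0 L) x :=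
  ((hu.differentiableOn hn) x hx).hasDerivWithinAt

theorem contDiffOn_dx {L : ℝ} (hL : 0 < L) {u : ℝ → ℝ} (hu : ContDiffOn ℝ 2 u (Set.Icc 0 L)) :
    ContDiffOn ℝ 1 (dx L u) (Set.Icc 0 L) :=
  hu.derivWithin (uniqueDiffOn_Icc hL) (by norm_num)

theorem friction_pos {κ μ H V : ℝ} (hκ : 0 < κ) (hμ : 0 < μ) (hH : 0 < H) (hV : 0 < V) :
    0 < friction κ μ H V := by
  unfold friction; positivity

/-- Friction is `O(μ)` uniformly in `κ`, because `f = 3κμV / (3μ + κH)`. -/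
theorem friction_mul_le {κ μ H V : ℝ} (hκ : 0 < κ) (hμ : 0 < μ) (hH : 0 < H) (hV : 0 < V) :
    friction κ μ H V * H ≤ 3 * μ * V := by
  unfold friction
  rw [div_mul_eq_mul_div, div_le_iff₀ (by positivity)]
  have : 3 * μ * V * (1 + κ * H / (3 * μ)) = 3 * μ * V + κ * V * H := by field_simp
  rw [this]
  have : 0 < 3 * μ * V := by positivity
  linarith

theorem friction_sq_div_le {κ μ H V : ℝ} (hκ : 0 < κ) (hμ : 0 < μ) (hH : 0 < H) (hV : 0 < V) :
    friction κ μ H V ^ 2 / (3 * μ * V) ≤ friction κ μ H V / H := by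
  have h1 := friction_mul_le hκ hμ hH hV
  have h2 := friction_pos hκ hμ hH hV
  rw [div_le_div_iff₀ (by positivity) hH]
  nlinarith

/-- The matching lower bound of order `μ`, which sets the decay rate. -/
theorem le_friction {κ μ H V H₀ V₀ : ℝ} (hκ : 0 < κ) (hμ : 0 < μ) (hμ1 : μ ≤ 1) (hH : 0 < H)
    (hV₀ : 0 < V₀) (hH₀ : H ≤ H₀) (hV : V₀ ≤ V) :
    3 * κ * V₀ / (3 + κ * H₀) * μ ≤ friction κ μ H V := by
  have : friction κ μ H V = 3 * κ * V * μ / (3 * μ + κ * H) := by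
    unfold friction
    field_simp
  rw [this, div_mul_eq_mul_div]
  have hV' : 0 < V := hV₀.trans_le hV
  gcongr
  linarith

/-! ### The steady state as a first-order equation for the stress -/

namespace IsSteadyState

variable {g κ μ L H₀ V₀ : ℝ} {H V : ℝ → ℝ}

theorem hasDerivWithinAt_H (hs : IsSteadyState g κ μ L H₀ V₀ H V) {x : ℝ}
    (hx : x ∈ Set.Icc 0 L) : HasDerivWithinAt H (dx L H x) (Set.Icc 0 L) x :=
  hasDerivWithinAt_dx hs.contDiff_H (by norm_num) hx

theorem hasDerivWithinAt_V (hs : IsSteadyState g κ μ L H₀ V₀ H V) {x : ℝ}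
    (hx : x ∈ Set.Icc 0 L) : HasDerivWithinAt V (dx L V x) (Set.Icc 0 L) x :=
  hasDerivWithinAt_dx hs.contDiff_V (by norm_num) hx

theorem contDiffOn_stress (hs : IsSteadyState g κ μ L H₀ V₀ H V) (hL : 0 < L) :
    ContDiffOn ℝ 1 (stress L H V) (Set.Icc 0 L) :=
  (hs.contDiff_H.of_le (by norm_num)).mul (contDiffOn_dx hL hs.contDiff_V)

theorem dx_mass (hs : IsSteadyState g κ μ L H₀ V₀ H V) (hL : 0 < L) {x : ℝ}
    (hx : x ∈ Set.Icc 0 L) : dx L H x * V x = -stress L H V x := by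
  have h := hs.mass x hx
  have h2 := ((hs.hasDerivWithinAt_H hx).mul (hs.hasDerivWithinAt_V hx)).derivWithin
    (uniqueDiffOn_Icc hL x hx)
  have h3 : dx L (fun s => H s * V s) x = dx L H x * V x + H x * dx L V x := h2
  simp only [stress]
  linarith

theorem mul_eq (hs : IsSteadyState g κ μ L H₀ V₀ H V) {x : ℝ}
    (hx : x ∈ Set.Icc 0 L) : H x * V x = H₀ * V₀ := by
  have hc : ContDiffOn ℝ 2 (fun s => H s * V s) (Set.Icc 0 L) := hs.contDiff_H.mul hs.contDiff_V
  have := constant_of_derivWithin_zero (hc.differentiableOn (by norm_num))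
    (fun y hy => hs.mass y ⟨hy.1, hy.2.le⟩) x hx
  rw [this, hs.H_zero, hs.V_zero]

theorem hasDerivWithinAt_stress (hs : IsSteadyState g κ μ L H₀ V₀ H V) (hL : 0 < L) (hμ : 0 < μ)
    {x : ℝ} (hx : x ∈ Set.Icc 0 L) :
    HasDerivWithinAt (stress L H V)
      ((friction κ μ (H x) (V x) - (g * H x / V x - V x) * stress L H V x) / (4 * μ))
      (Set.Icc 0 L) x := by
  have h := hasDerivWithinAt_dx (hs.contDiffOn_stress hL) one_ne_zero hx
  convert h using 1
  have hm := hs.momentum x hx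
  have h1 := hs.dx_mass hL hx
  have hH := hs.pos_H x hx
  have hV := hs.pos_V x hx
  change V x * dx L V x + g * dx L H x + friction κ μ (H x) (V x) / H x
      - 4 * μ * (dx L (stress L H V) x / H x) = 0 at hm
  have h2 : dx L H x = -stress L H V x / V x := by rw [eq_div_iff hV.ne', h1]
  have h3 : dx L V x = stress L H V x / H x := by rw [stress]; field_simp
  rw [h2, h3] at hm
  rw [div_eq_iff (by positivity)]
  field_simp at hm ⊢
  linear_combination hm

theorem stress_zero (hs : IsSteadyState g κ μ L H₀ V₀ H V) : stress L H V 0 = 0 := by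
  simp [stress, hs.dx_V_zero]

end IsSteadyState

/-! ### Minimum principle and bounds on the steady state -/

/-- At a minimum point `x > 0` over `[0, L]`, the derivative is nonpositive. -/
theorem hasDerivWithinAt_nonpos_of_isMinOn {L x u' : ℝ} {u : ℝ → ℝ} (hx0 : 0 < x) (hxL : x ≤ L)
    (hmin : IsMinOn u (Set.Icc 0 L) x) (hu : HasDerivWithinAt u u' (Set.Icc 0 L) x) : u' ≤ 0 := by
  -- Only left difference quotients enter, so the end point `x = L` is covered.
  have h1 : HasDerivWithinAt u u' (Set.Ioo 0 x) x :=
    hu.mono fun y hy => ⟨hy.1.le, hy.2.le.trans hxL⟩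
  rw [hasDerivWithinAt_iff_tendsto_slope] at h1
  have hne : (nhdsWithin x (Set.Ioo 0 x \ {x})).NeBot := by
    rw [Set.sdiff_singleton_eq_self (by simp)]
    exact right_nhdsWithin_Ioo_neBot hx0
  refine le_of_tendsto h1 ?_
  filter_upwards [self_mem_nhdsWithin] with y hy
  have hy' := hy.1
  rw [slope_def_field]
  exact div_nonpos_of_nonneg_of_nonpos
    (sub_nonneg.2 (hmin ⟨hy'.1.le, hy'.2.le.trans hxL⟩)) (by linarith [hy'.2])

/-- A function on `[0, L]` that is nonnegative at `0` and has positive derivative wherever it is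
negative is nonnegative. -/
theorem nonneg_of_deriv_pos_of_neg {L : ℝ} {u u' : ℝ → ℝ} (h0 : 0 ≤ u 0)
    (hu : ∀ x ∈ Set.Icc 0 L, HasDerivWithinAt u (u' x) (Set.Icc 0 L) x)
    (hpos : ∀ x ∈ Set.Icc 0 L, u x < 0 → 0 < u' x) : ∀ x ∈ Set.Icc 0 L, 0 ≤ u x := by
  intro x hx
  obtain ⟨z, hz, hmin⟩ := isCompact_Icc.exists_isMinOn ⟨x, hx⟩
    (fun y hy => (hu y hy).continuousWithinAt)
  refine le_trans ?_ (hmin hx)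
  by_contra! hneg
  have hz0 : 0 < z := lt_of_le_of_ne hz.1 (by rintro rfl; linarith)
  exact absurd (hasDerivWithinAt_nonpos_of_isMinOn hz0 hz.2 hmin (hu z hz))
    (not_le.2 (hpos z hz hneg))

namespace IsSteadyState

variable {g κ μ L H₀ V₀ : ℝ} {H V : ℝ → ℝ}

theorem wave_pos (hs : IsSteadyState g κ μ L H₀ V₀ H V) {x : ℝ} (hx : x ∈ Set.Icc 0 L) :
    0 < g * H x / V x - V x := by
  have hV := hs.pos_V x hx
  have := hs.subcritical x hx
  rw [sub_pos, lt_div_iff₀ hV]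
  nlinarith

theorem stress_nonneg (hs : IsSteadyState g κ μ L H₀ V₀ H V) (hL : 0 < L) (hκ : 0 < κ)
    (hμ : 0 < μ) : ∀ x ∈ Set.Icc 0 L, 0 ≤ stress L H V x := by
  refine nonneg_of_deriv_pos_of_neg hs.stress_zero.ge
    (fun x hx => hs.hasDerivWithinAt_stress hL hμ hx) fun x hx hneg => ?_
  have := hs.wave_pos hx
  have := friction_pos hκ hμ (hs.pos_H x hx) (hs.pos_V x hx)
  apply div_pos _ (by positivity)
  nlinarith

theorem dx_V_eq (hs : IsSteadyState g κ μ L H₀ V₀ H V) {x : ℝ} (hx : x ∈ Set.Icc 0 L) :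
    dx L V x = stress L H V x / H x := by
  have := hs.pos_H x hx
  rw [stress]; field_simp

theorem dx_H_eq (hs : IsSteadyState g κ μ L H₀ V₀ H V) (hL : 0 < L) {x : ℝ}
    (hx : x ∈ Set.Icc 0 L) : dx L H x = -stress L H V x / V x := by
  rw [eq_div_iff (hs.pos_V x hx).ne', hs.dx_mass hL hx]

/-- For `u = f - a w` one has `u' = f' - a' w - a u / (4μ)`. Here `f' ≥ 0` and `a' ≤ 0`, because `V`
grows and `H` falls, so `u' > 0` wherever `u < 0`. -/
theorem wave_mul_stress_le (hs : IsSteadyState g κ μ L H₀ V₀ H V) (hL : 0 < L) (hκ : 0 < κ)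
    (hμ : 0 < μ) (hg : 0 < g) : ∀ x ∈ Set.Icc 0 L,
    (g * H x / V x - V x) * stress L H V x ≤ friction κ μ (H x) (V x) := by
  have key := nonneg_of_deriv_pos_of_neg (L := L)
    (u := fun x => friction κ μ (H x) (V x) - (g * H x / V x - V x) * stress L H V x) ?_
    (fun x hx => by
      have hH := hs.pos_H x hx
      have hV := hs.pos_V x hx
      have hd := hs.hasDerivWithinAt_H hx
      have hd' := hs.hasDerivWithinAt_V hx
      exact ((hd'.const_mul κ).fun_div (((hd.const_mul κ).div_const (3 * μ)).const_add 1)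
        (by positivity)).fun_sub ((((hd.const_mul g).fun_div hd' hV.ne').fun_sub hd').fun_mul
          (hs.hasDerivWithinAt_stress hL hμ hx))) ?_
  · intro x hx
    linarith [key x hx]
  · have h0 : (0 : ℝ) ∈ Set.Icc 0 L := ⟨le_rfl, hL.le⟩
    simp only [hs.stress_zero, mul_zero, sub_zero]
    exact (friction_pos hκ hμ (hs.pos_H 0 h0) (hs.pos_V 0 h0)).le
  · intro x hx hneg
    have hH := hs.pos_H x hx
    have hV := hs.pos_V x hx
    have ha := hs.wave_pos hx
    have hw := hs.stress_nonneg hL hκ hμ x hx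
    have hVx : 0 ≤ dx L V x := by rw [hs.dx_V_eq hx]; positivity
    have hHx : dx L H x ≤ 0 := by
      rw [hs.dx_H_eq hL hx]; exact div_nonpos_of_nonpos_of_nonneg (by linarith) hV.le
    have h1 : 0 ≤ (κ * dx L V x * (1 + κ * H x / (3 * μ)) - κ * V x * (κ * dx L H x / (3 * μ)))
        / (1 + κ * H x / (3 * μ)) ^ 2 := by
      have : κ * dx L H x / (3 * μ) ≤ 0 :=
        div_nonpos_of_nonpos_of_nonneg (by nlinarith) (by positivity)
      have h2 : 0 ≤ κ * V x * -(κ * dx L H x / (3 * μ)) :=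
        mul_nonneg (by positivity) (by linarith)
      have h3 : 0 ≤ κ * dx L V x * (1 + κ * H x / (3 * μ)) := by positivity
      apply div_nonneg _ (by positivity)
      linarith
    have h2 : ((g * dx L H x * V x - g * H x * dx L V x) / V x ^ 2 - dx L V x)
        * stress L H V x ≤ 0 := by
      apply mul_nonpos_of_nonpos_of_nonneg _ hw
      have : (g * dx L H x * V x - g * H x * dx L V x) / V x ^ 2 ≤ 0 := by
        apply div_nonpos_of_nonpos_of_nonneg _ (by positivity)
        have : 0 ≤ g * H x * dx L V x := by positivity
        have : 0 ≤ g * -dx L H x * V x :=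
          mul_nonneg (mul_nonneg hg.le (by linarith)) hV.le
        linarith
      linarith
    have h3 : (g * H x / V x - V x) * ((friction κ μ (H x) (V x)
        - (g * H x / V x - V x) * stress L H V x) / (4 * μ)) < 0 :=
      mul_neg_of_pos_of_neg ha (div_neg_of_neg_of_pos hneg (by positivity))
    linarith

theorem monotoneOn_V (hs : IsSteadyState g κ μ L H₀ V₀ H V) (hL : 0 < L) (hκ : 0 < κ)
    (hμ : 0 < μ) : MonotoneOn V (Set.Icc 0 L) := by
  refine monotoneOn_of_hasDerivWithinAt_nonneg (convex_Icc 0 L) hs.contDiff_V.continuousOn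
    (f' := dx L V) (fun x hx => ?_) fun x hx => ?_
  · exact (hs.hasDerivWithinAt_V (interior_subset hx)).mono interior_subset
  · have hx := interior_subset hx
    rw [hs.dx_V_eq hx]
    exact div_nonneg (hs.stress_nonneg hL hκ hμ x hx) (hs.pos_H x hx).le

theorem V₀_le (hs : IsSteadyState g κ μ L H₀ V₀ H V) (hL : 0 < L) (hκ : 0 < κ)
    (hμ : 0 < μ) {x : ℝ} (hx : x ∈ Set.Icc 0 L) : V₀ ≤ V x :=
  hs.V_zero ▸ hs.monotoneOn_V hL hκ hμ ⟨le_rfl, hL.le⟩ hx hx.1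

theorem le_H₀ (hs : IsSteadyState g κ μ L H₀ V₀ H V) (hL : 0 < L) (hκ : 0 < κ)
    (hμ : 0 < μ) (hV₀ : 0 < V₀) {x : ℝ} (hx : x ∈ Set.Icc 0 L) : H x ≤ H₀ := by
  have h1 := hs.mul_eq hx
  have h2 := hs.V₀_le hL hκ hμ hx
  have h3 := hs.pos_H x hx
  have : H x * V₀ ≤ H₀ * V₀ := by rw [← h1]; gcongr
  exact le_of_mul_le_mul_right this hV₀

theorem le_H (hs : IsSteadyState g κ μ L H₀ V₀ H V) {V₁ : ℝ} {x : ℝ}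
    (hx : x ∈ Set.Icc 0 L) (hV₁ : V x ≤ V₁) : H₀ * V₀ / V₁ ≤ H x := by
  have h3 := hs.pos_H x hx
  rw [div_le_iff₀ ((hs.pos_V x hx).trans_le hV₁), ← hs.mul_eq hx]
  gcongr

/-- The stress is `O(μ)` where the velocity stays away from the critical one. -/
theorem stress_le (hs : IsSteadyState g κ μ L H₀ V₀ H V) (hL : 0 < L) (hκ : 0 < κ) (hμ : 0 < μ)
    (hg : 0 < g) (hH₀ : 0 < H₀) (hV₀ : 0 < V₀) {V₁ : ℝ} (hcrit : V₁ ^ 3 < g * (H₀ * V₀)) {x : ℝ}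
    (hx : x ∈ Set.Icc 0 L) (hV₁ : V x ≤ V₁) :
    stress L H V x ≤ 3 * V₁ ^ 4 / (H₀ * V₀ * (g * (H₀ * V₀) - V₁ ^ 3)) * μ := by
  have hH := hs.pos_H x hx
  have hV := hs.pos_V x hx
  have h1 := hs.wave_mul_stress_le hL hκ hμ hg x hx
  have h2 := friction_mul_le hκ hμ hH hV
  have hw := hs.stress_nonneg hL hκ hμ x hx
  have hm := hs.mul_eq hx
  have hV₁0 : 0 < V₁ := hV.trans_le hV₁
  have hd : 0 < g * (H₀ * V₀) - V₁ ^ 3 := by linarith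
  rw [div_mul_eq_mul_div, le_div_iff₀ (by positivity), ← hm]
  -- As `H V` is constant, `hcrit` keeps this quantity away from zero while `V ≤ V₁`.
  have h3 : (g * H x / V x - V x) * V x ^ 2 = g * (H x * V x) - V x ^ 3 := by field_simp
  have hle : V x ^ 3 ≤ V₁ ^ 3 := by gcongr
  have h4 : stress L H V x * (H x * (g * (H x * V x) - V₁ ^ 3)) ≤ 3 * μ * V x ^ 3 := by
    calc stress L H V x * (H x * (g * (H x * V x) - V₁ ^ 3))
        ≤ stress L H V x * (H x * (g * (H x * V x) - V x ^ 3)) := by gcongr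
      _ = (g * H x / V x - V x) * stress L H V x * (H x * V x ^ 2) := by rw [← h3]; ring
      _ ≤ friction κ μ (H x) (V x) * (H x * V x ^ 2) := by gcongr
      _ = friction κ μ (H x) (V x) * H x * V x ^ 2 := by ring
      _ ≤ 3 * μ * V x * V x ^ 2 := by gcongr
      _ = _ := by ring
  calc stress L H V x * (H x * V x * (g * (H x * V x) - V₁ ^ 3))
      = stress L H V x * (H x * (g * (H x * V x) - V₁ ^ 3)) * V x := by ring
    _ ≤ 3 * μ * V x ^ 3 * V x := by gcongr
    _ = 3 * V x ^ 4 * μ := by ring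
    _ ≤ 3 * V₁ ^ 4 * μ := by gcongr

/-- For small viscosity the velocity of a steady state stays close to its inflow value. -/
theorem V_le (hs : IsSteadyState g κ μ L H₀ V₀ H V) (hL : 0 < L) (hκ : 0 < κ) (hμ : 0 < μ)
    (hg : 0 < g) (hH₀ : 0 < H₀) (hV₀ : 0 < V₀) {V₁ : ℝ} (hV₁ : V₀ < V₁)
    (hcrit : V₁ ^ 3 < g * (H₀ * V₀))
    (hsmall : 3 * V₁ ^ 5 / ((H₀ * V₀) ^ 2 * (g * (H₀ * V₀) - V₁ ^ 3)) * μ * L < V₁ - V₀)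
    {x : ℝ} (hx : x ∈ Set.Icc 0 L) : V x ≤ V₁ := by
  have hV₁0 := hV₀.trans hV₁
  have hd : 0 < g * (H₀ * V₀) - V₁ ^ 3 := by linarith
  by_contra! hlt
  -- If `V` exceeded `V₁` it would take the value `V₁` at some `s`. On `[0, s]` monotonicity gives
  -- `V ≤ V₁`, so `V_x = O(μ)` there, too small a slope to climb from `V₀` to `V₁`.
  obtain ⟨s, hs0, hsV⟩ : V₁ ∈ V '' Set.Icc 0 x :=
    intermediate_value_Icc hx.1 (hs.contDiff_V.continuousOn.mono (Set.Icc_subset_Icc_right hx.2))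
      ⟨hs.V_zero.trans_le hV₁.le, hlt.le⟩
  have hsub : Set.Icc 0 s ⊆ Set.Icc 0 L := Set.Icc_subset_Icc_right (hs0.2.trans hx.2)
  have hs_mem : s ∈ Set.Icc 0 L := hsub ⟨hs0.1, le_rfl⟩
  have hbound := Convex.norm_image_sub_le_of_norm_hasDerivWithin_le (f := V) (f' := dx L V)
    (s := Set.Icc 0 s) (C := 3 * V₁ ^ 5 / ((H₀ * V₀) ^ 2 * (g * (H₀ * V₀) - V₁ ^ 3)) * μ)
    (x := 0) (y := s)
    (fun z hz => (hs.hasDerivWithinAt_V (hsub hz)).mono hsub) (fun z hz => by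
      have hzL := hsub hz
      have hVz : V z ≤ V₁ := hsV ▸ hs.monotoneOn_V hL hκ hμ hzL hs_mem hz.2
      have hw := hs.stress_nonneg hL hκ hμ z hzL
      have hH := hs.pos_H z hzL
      have h1 := hs.stress_le hL hκ hμ hg hH₀ hV₀ hcrit hzL hVz
      have h2 := hs.le_H hzL hVz
      rw [hs.dx_V_eq hzL, Real.norm_of_nonneg (by positivity)]
      calc stress L H V z / H z
          ≤ (3 * V₁ ^ 4 / (H₀ * V₀ * (g * (H₀ * V₀) - V₁ ^ 3)) * μ) / (H₀ * V₀ / V₁) := by gcongr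
        _ = _ := by field_simp) (convex_Icc 0 s) ⟨le_rfl, hs0.1⟩ ⟨hs0.1, le_rfl⟩
  rw [hsV, hs.V_zero, Real.norm_of_nonneg (by linarith), sub_zero, Real.norm_of_nonneg hs0.1]
    at hbound
  have : 3 * V₁ ^ 5 / ((H₀ * V₀) ^ 2 * (g * (H₀ * V₀) - V₁ ^ 3)) * μ * s
      ≤ 3 * V₁ ^ 5 / ((H₀ * V₀) ^ 2 * (g * (H₀ * V₀) - V₁ ^ 3)) * μ * L := by
    gcongr
    exact hs_mem.2
  linarith

end IsSteadyState

/-! ### Quadratic forms -/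

/-- Completing the square `(V|h| - √2 H|v|)²`; the factor `s < 1` measures the distance from the
degenerate case `|k| = √2 F/H`. -/
theorem quadratic_form_le {V H F s k h v : ℝ} (hV : 0 < V) (hH : 0 < H) (hF : 0 ≤ F) (hs : 0 ≤ s)
    (hk : |k| ≤ √2 * s * F / H) :
    -(V / H ^ 2 * F) * h ^ 2 + 2 * k * (h * v) - 2 * F / V * v ^ 2
      ≤ -((1 - s) * F * (V / H ^ 2 * h ^ 2 + 2 / V * v ^ 2)) := by
  have h1 : k * (h * v) ≤ √2 * s * F / H * (|h| * |v|) := by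
    calc k * (h * v) ≤ |k * (h * v)| := le_abs_self _
      _ = |k| * (|h| * |v|) := by rw [abs_mul, abs_mul]
      _ ≤ _ := by gcongr
  have h2 : s * F * (V / H ^ 2 * h ^ 2 + 2 / V * v ^ 2) - 2 * (√2 * s * F / H * (|h| * |v|))
      = s * F / (V * H ^ 2) * (V * |h| - √2 * H * |v|) ^ 2 := by
    have e1 : (√2) ^ 2 = 2 := Real.sq_sqrt (by norm_num)
    rw [← sq_abs h, ← sq_abs v]
    field_simp
    linear_combination (-(s * F * H ^ 2 * |v| ^ 2)) * e1
  have h3 : 0 ≤ s * F / (V * H ^ 2) * (V * |h| - √2 * H * |v|) ^ 2 := by positivity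
  have h4 : -(V / H ^ 2 * F) * h ^ 2 - 2 * F / V * v ^ 2
      = -(F * (V / H ^ 2 * h ^ 2 + 2 / V * v ^ 2)) := by ring
  linarith

theorem exists_ratio_lt_one {r : ℝ} (hr : 0 < r) (hr' : r < 1 + √2) :
    ∃ s : ℝ, 0 ≤ s ∧ s < 1 ∧ ∀ f w a V : ℝ, 0 ≤ w → a * w ≤ f → 0 ≤ a → a ≤ r * V →
      a * w + f ≤ √2 * s * (f + V * w) := by
  have h2 : (√2) ^ 2 = 2 := Real.sq_sqrt (by norm_num)
  have h2' : 1 < √2 := by rw [Real.lt_sqrt] <;> norm_num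
  have h2'' : √2 < 2 := by rw [Real.sqrt_lt] <;> norm_num
  -- The second entry settles the extremal case `a w = f`, `a = r V`, and is below `1` exactly when
  -- `r < 1 + √2`. The first gives `√2 s ≥ 1`, so that `f > a w` only helps.
  refine ⟨max (√2 / 2) (√2 * r / (1 + r)), by positivity, ?_, ?_⟩
  · refine max_lt (by linarith) ?_
    rw [div_lt_one (by linarith)]
    have : (√2 - 1) * r < (√2 - 1) * (1 + √2) := by
      apply mul_lt_mul_of_pos_left hr' (by linarith)
    nlinarith
  · intro f w a V hw haw ha haV
    set s := max (√2 / 2) (√2 * r / (1 + r))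
    have hs1 : 1 ≤ √2 * s := by
      have : √2 / 2 ≤ s := le_max_left _ _
      nlinarith
    have hs2 : 2 * r ≤ √2 * s * (1 + r) := by
      have : √2 * r / (1 + r) ≤ s := le_max_right _ _
      rw [div_le_iff₀ (by linarith)] at this
      nlinarith
    have hT : 0 ≤ a * w := mul_nonneg ha hw
    have hVw : a * w ≤ r * (V * w) := by nlinarith
    have h1 : 0 ≤ (√2 * s - 1) * (f - a * w) := mul_nonneg (by linarith) (by linarith)
    have h3 : 0 ≤ a * w * (√2 * s * (1 + r) - 2 * r) := mul_nonneg hT (by linarith)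
    have h4 : 0 ≤ (√2 * s) * (r * (V * w) - a * w) := mul_nonneg (by linarith) (by linarith)
    -- The right-hand side is `r` times the quantity in `h1` plus those in `h3` and `h4`.
    have : 0 ≤ r * (√2 * s * (f + V * w) - (a * w + f)) := by nlinarith
    have := nonneg_of_mul_nonneg_right this hr
    linarith

/-- The boundary form at the outflow end is nonnegative, up to a small multiple of the square of
the outflow velocity. -/
theorem outflow_form_nonneg {g H V b c δ e h v ζ : ℝ} (hg : 0 < g) (hH : 0 < H) (hV : 0 < V)
    (hc : c ≠ 0) (hquad : (g * H - V ^ 2) * c ^ 2 + 8 * c * (V + H * b) + 16 * H * b ^ 2 / g ≤ 0)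
    (hv : v = b * h + c * ζ) (hδ : 0 ≤ δ) (h1 : δ * (2 * (V + H)) ≤ g * V)
    (h2 : δ * (2 * (V + H) * (H * (g + 4 * (b / c)) / (g * V)) ^ 2 + H) ≤ e) :
    0 ≤ (g - δ) * V * h ^ 2 + 2 * ((g - δ) * H) * (h * v) + H * V * v ^ 2 - 8 * H * (v * ζ)
      + e * v ^ 2 := by
  set β := H * (g + 4 * (b / c)) / (g * V) with hβ
  have hζ : ζ = v / c - b / c * h := by rw [hv]; field_simp; ring
  have hβ' : β * (g * V) = H * (g + 4 * (b / c)) := by rw [hβ]; field_simp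
  -- After `ζ` is eliminated, completing the square in `h` leaves this coefficient of `v²`; it is a
  -- nonpositive multiple of the quadratic in `hquad`.
  have hγ : 0 ≤ H * V - 8 * H / c - g * V * β ^ 2 := by
    have e1 : H * V - 8 * H / c - g * V * β ^ 2 = -(H / (V * c ^ 2)) *
        ((g * H - V ^ 2) * c ^ 2 + 8 * c * (V + H * b) + 16 * H * b ^ 2 / g) := by
      rw [hβ]; field_simp; ring
    rw [e1]
    apply mul_nonneg_of_nonpos_of_nonpos _ hquad
    have : 0 < c ^ 2 := by positivity
    rw [neg_nonpos]; positivity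
  have key : (g - δ) * V * h ^ 2 + 2 * ((g - δ) * H) * (h * v) + H * V * v ^ 2 - 8 * H * (v * ζ)
      + e * v ^ 2 = g * V * (h + β * v) ^ 2 + (H * V - 8 * H / c - g * V * β ^ 2) * v ^ 2
        + e * v ^ 2 - δ * (V * h ^ 2 + 2 * H * (h * v)) := by
    rw [hζ]
    linear_combination (-2 * h * v) * hβ'
  -- Uses `2hv ≤ h² + v²` and `h² ≤ 2(h + βv)² + 2β²v²`, to absorb the `δ` error into the two
  -- squares.
  have h3 : V * h ^ 2 + 2 * H * (h * v) ≤ 2 * (V + H) * (h + β * v) ^ 2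
      + (2 * (V + H) * β ^ 2 + H) * v ^ 2 := by
    have : 0 ≤ H * (h - v) ^ 2 := by positivity
    have : 0 ≤ (V + H) * (h + 2 * β * v) ^ 2 := by positivity
    nlinarith
  have h4 := mul_le_mul_of_nonneg_left h3 hδ
  have h5 := mul_le_mul_of_nonneg_right h1 (sq_nonneg (h + β * v))
  have h6 := mul_le_mul_of_nonneg_right h2 (sq_nonneg v)
  have h7 := mul_nonneg hγ (sq_nonneg v)
  rw [key]
  linarith

/-- The numbers `c₁^±` are the roots of this quadratic in `c₁`, whose leading coefficient is
positive. -/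
theorem outflow_discriminant {g L b₀ b₁ c₁ : ℝ} {H V : ℝ → ℝ} (hg : 0 < g)
    (hsub : V L ^ 2 < g * H L) (hbc : BoundaryCondition g L b₀ b₁ c₁ H V) :
    (g * H L - V L ^ 2) * c₁ ^ 2 + 8 * c₁ * (V L + H L * b₁) + 16 * H L * b₁ ^ 2 / g < 0 := by
  obtain ⟨hl, hr⟩ := hbc.hc₁
  have hΔ : 0 < H L * g - V L ^ 2 := by linarith
  rw [div_lt_iff₀ hΔ] at hl
  rw [lt_div_iff₀ hΔ] at hr
  have := Real.sq_lt.2 ⟨show -√(V L * (H L * V L * b₁ ^ 2 / g + 2 * H L * b₁ + V L))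
    < c₁ * (H L * g - V L ^ 2) / 4 + V L + b₁ * H L by linarith, by linarith⟩
  have e1 : (c₁ * (H L * g - V L ^ 2) / 4 + V L + b₁ * H L) ^ 2
      - V L * (H L * V L * b₁ ^ 2 / g + 2 * H L * b₁ + V L)
      = (H L * g - V L ^ 2) / 16 * ((g * H L - V L ^ 2) * c₁ ^ 2 + 8 * c₁ * (V L + H L * b₁)
        + 16 * H L * b₁ ^ 2 / g) := by
    field_simp; ring
  by_contra! hcon
  have := mul_nonneg (show 0 ≤ (H L * g - V L ^ 2) / 16 by linarith) hcon
  linarith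

theorem outflow_coefficient_ne_zero {g L b₀ b₁ c₁ : ℝ} {H V : ℝ → ℝ} (hg : 0 < g) (hH : 0 < H L)
    (hsub : V L ^ 2 < g * H L) (hbc : BoundaryCondition g L b₀ b₁ c₁ H V) : c₁ ≠ 0 := by
  rintro rfl
  have := outflow_discriminant hg hsub hbc
  have : 0 ≤ 16 * H L * b₁ ^ 2 / g := by positivity
  linarith

/-- The boundary form at the inflow end is nonpositive. -/
theorem inflow_form_nonpos {g L b₀ b₁ c₁ : ℝ} {H V : ℝ → ℝ} (hg : 0 < g) (hH : 0 < H 0)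
    (hV : 0 < V 0) (hbc : BoundaryCondition g L b₀ b₁ c₁ H V) (h : ℝ) :
    g * V 0 * h ^ 2 + 2 * (g * H 0) * (h * (-b₀ * h)) + H 0 * V 0 * (-b₀ * h) ^ 2 ≤ 0 := by
  obtain ⟨hl, hr⟩ := hbc.hb₀
  rw [← lt_div_iff₀' hg] at hl
  rw [← div_lt_iff₀' hg] at hr
  have h1 := Real.sq_lt.2 ⟨show -√(1 / V 0 ^ 2 - 1 / (g * H 0)) < b₀ / g - 1 / V 0 by linarith,
    by linarith⟩
  have e1 : g * V 0 * h ^ 2 + 2 * (g * H 0) * (h * (-b₀ * h)) + H 0 * V 0 * (-b₀ * h) ^ 2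
      = g ^ 2 * H 0 * V 0 * h ^ 2
        * ((b₀ / g - 1 / V 0) ^ 2 - (1 / V 0 ^ 2 - 1 / (g * H 0))) := by
    field_simp; ring
  rw [e1]
  exact mul_nonpos_of_nonneg_of_nonpos (by positivity) (by linarith)

/-- The weight of `h ^ 2` in the Lyapunov function, up to the factor `1 + μ`. -/
def weight (g μ L : ℝ) (H V : ℝ → ℝ) (x : ℝ) : ℝ := g - 4 * μ * (dx L V x / H x)

/-- The derivative of `weight` along a steady state. -/
def weightDeriv (g κ μ L : ℝ) (H V : ℝ → ℝ) (x : ℝ) : ℝ :=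
  -((friction κ μ (H x) (V x) - (g * H x / V x - V x) * stress L H V x) / H x ^ 2
    + 8 * μ * stress L H V x ^ 2 / (H x ^ 3 * V x))

/-- The quadratic form in `(h, v)` which governs the decay of the Lyapunov function in the
interior of the channel. -/
def interiorForm (g κ μ L : ℝ) (H V : ℝ → ℝ) (x h v : ℝ) : ℝ :=
  (weightDeriv g κ μ L H V x * V x - weight g μ L H V x * dx L V x) * h ^ 2
    + 2 * (weightDeriv g κ μ L H V x * H x - H x * matC κ μ L H V x 1 0) * (h * v)
    - 2 * (H x * matC κ μ L H V x 1 1) * v ^ 2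

/-! ### Definiteness of the interior form -/

namespace IsSteadyState

variable {g κ μ L H₀ V₀ : ℝ} {H V : ℝ → ℝ}

theorem weight_eq (hs : IsSteadyState g κ μ L H₀ V₀ H V) {x : ℝ} (hx : x ∈ Set.Icc 0 L) :
    weight g μ L H V x = g - 4 * μ * stress L H V x / H x ^ 2 := by
  have := hs.pos_H x hx
  rw [weight, hs.dx_V_eq hx]; field_simp

theorem contDiffOn_weight (hs : IsSteadyState g κ μ L H₀ V₀ H V) (hL : 0 < L) :
    ContDiffOn ℝ 1 (weight g μ L H V) (Set.Icc 0 L) :=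
  contDiffOn_const.sub (contDiffOn_const.mul ((contDiffOn_dx hL hs.contDiff_V).div
    (hs.contDiff_H.of_le (by norm_num)) fun x hx => (hs.pos_H x hx).ne'))

theorem hasDerivWithinAt_weight (hs : IsSteadyState g κ μ L H₀ V₀ H V) (hL : 0 < L) (hμ : 0 < μ)
    {x : ℝ} (hx : x ∈ Set.Icc 0 L) :
    HasDerivWithinAt (weight g μ L H V) (weightDeriv g κ μ L H V x) (Set.Icc 0 L) x := by
  have hH := hs.pos_H x hx
  have hV := hs.pos_V x hx
  have h1 := (((hs.hasDerivWithinAt_stress hL hμ hx).const_mul (4 * μ)).fun_div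
    ((hs.hasDerivWithinAt_H hx).fun_pow 2) (by positivity)).const_sub g
  refine (h1.congr_of_mem (fun y hy => hs.weight_eq hy) hx).congr_deriv ?_
  rw [weightDeriv, hs.dx_H_eq hL hx]
  field_simp
  ring

theorem interiorForm_eq (hs : IsSteadyState g κ μ L H₀ V₀ H V) (hL : 0 < L) (hμ : 0 < μ)
    {x : ℝ} (hx : x ∈ Set.Icc 0 L) (h v : ℝ) :
    interiorForm g κ μ L H V x h v =
      (-(V x / H x ^ 2 * (friction κ μ (H x) (V x) + V x * stress L H V x))
        - 4 * μ * stress L H V x ^ 2 / H x ^ 3) * h ^ 2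
      + 2 * ((g * H x / V x - V x) * stress L H V x / H x
        + friction κ μ (H x) (V x) ^ 2 / (3 * μ * V x)
        - 4 * μ * stress L H V x ^ 2 / (H x ^ 2 * V x)) * (h * v)
      - 2 * (friction κ μ (H x) (V x) + V x * stress L H V x) / V x * v ^ 2 := by
  have hH := hs.pos_H x hx
  have hV := hs.pos_V x hx
  simp only [interiorForm, weightDeriv, hs.weight_eq hx, matC, hs.dx_V_eq hx, hs.dx_H_eq hL hx,
    Matrix.of_apply, Matrix.cons_val', Matrix.cons_val_zero, Matrix.cons_val_one]
  generalize friction κ μ (H x) (V x) = f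
  generalize stress L H V x = w
  field_simp
  ring

theorem interiorForm_le (hs : IsSteadyState g κ μ L H₀ V₀ H V) (hL : 0 < L) (hκ : 0 < κ)
    (hμ : 0 < μ) (hg : 0 < g) {s V₁ : ℝ} (hs0 : 0 ≤ s) (hs1 : s ≤ 1) (hμ1 : μ ≤ 1) (hV₀ : 0 < V₀)
    (hratio : ∀ f w a V : ℝ, 0 ≤ w → a * w ≤ f → 0 ≤ a → a ≤ (g * H₀ / V₀ ^ 2 - 1) * V →
      a * w + f ≤ √2 * s * (f + V * w))
    {x : ℝ} (hx : x ∈ Set.Icc 0 L) (hV₁ : V x ≤ V₁)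
    (hsmall : 4 * μ * stress L H V x ≤ (g * H x / V x - V x) * (H x * V x)) (h v : ℝ) :
    interiorForm g κ μ L H V x h v ≤
      -((1 - s) * (3 * κ * V₀ / (3 + κ * H₀)) * min (V₀ / H₀ ^ 2) (2 / V₁) * μ
        * (h ^ 2 + v ^ 2)) := by
  have hH := hs.pos_H x hx
  have hV := hs.pos_V x hx
  have hw := hs.stress_nonneg hL hκ hμ x hx
  have hf := friction_pos hκ hμ hH hV
  have haw := hs.wave_mul_stress_le hL hκ hμ hg x hx
  have ha := hs.wave_pos hx
  have hVx := hs.V₀_le hL hκ hμ hx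
  have hHx := hs.le_H₀ hL hκ hμ hV₀ hx
  have hfq := friction_sq_div_le hκ hμ hH hV
  have hflow := le_friction hκ hμ hμ1 hH hV₀ hHx hVx
  have har : g * H x / V x - V x ≤ (g * H₀ / V₀ ^ 2 - 1) * V x := by
    have h1 : g * H x / V x = g * H x / V x ^ 2 * V x := by field_simp
    have h2 : g * H x / V x ^ 2 ≤ g * H₀ / V₀ ^ 2 := by
      have : 0 < H₀ := hH.trans_le hHx
      gcongr
    rw [h1]; nlinarith
  have hr := hratio _ _ _ _ hw haw ha.le har
  rw [hs.interiorForm_eq hL hμ hx]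
  set f := friction κ μ (H x) (V x)
  set w := stress L H V x
  set a := g * H x / V x - V x
  set F := f + V x * w
  have hF : 0 < F := by positivity
  have hk : |a * w / H x + f ^ 2 / (3 * μ * V x) - 4 * μ * w ^ 2 / (H x ^ 2 * V x)|
      ≤ √2 * s * F / H x := by
    have h1 : 0 ≤ f ^ 2 / (3 * μ * V x) := by positivity
    have h2 : 0 ≤ 4 * μ * w ^ 2 / (H x ^ 2 * V x) := by positivity
    -- By `hsmall` the negative term of `k` does not outweigh the first one, so only the upper bound
    -- on `k` matters.
    have h3 : 4 * μ * w ^ 2 / (H x ^ 2 * V x) ≤ a * w / H x := by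
      rw [div_le_div_iff₀ (by positivity) hH]
      calc 4 * μ * w ^ 2 * H x = 4 * μ * w * (w * H x) := by ring
        _ ≤ a * (H x * V x) * (w * H x) := by gcongr
        _ = _ := by ring
    have h4 : (a * w + f) / H x ≤ √2 * s * F / H x := by gcongr
    rw [add_div] at h4
    have h5 : 0 ≤ a * w / H x := by positivity
    rw [abs_le]
    constructor <;> linarith
  have key := quadratic_form_le (h := h) (v := v) hV hH hF.le hs0 hk
  have h6 : 0 ≤ 4 * μ * w ^ 2 / H x ^ 3 * h ^ 2 := by positivity
  have hH₀ : 0 < H₀ := hH.trans_le hHx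
  have hV₁0 : 0 < V₁ := hV.trans_le hV₁
  have h7 : min (V₀ / H₀ ^ 2) (2 / V₁) * (h ^ 2 + v ^ 2)
      ≤ V x / H x ^ 2 * h ^ 2 + 2 / V x * v ^ 2 := by
    rw [mul_add]
    gcongr
    · refine (min_le_left _ _).trans ?_
      gcongr
    · refine (min_le_right _ _).trans ?_
      gcongr
  have h8 : 3 * κ * V₀ / (3 + κ * H₀) * μ ≤ F := hflow.trans (le_add_of_nonneg_right (by positivity))
  have hm : 0 ≤ min (V₀ / H₀ ^ 2) (2 / V₁) := le_min (by positivity) (by positivity)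
  have h9 : (1 - s) * (3 * κ * V₀ / (3 + κ * H₀)) * min (V₀ / H₀ ^ 2) (2 / V₁) * μ
        * (h ^ 2 + v ^ 2) ≤ (1 - s) * F * (V x / H x ^ 2 * h ^ 2 + 2 / V x * v ^ 2) := by
    have h1s : 0 ≤ 1 - s := by linarith
    calc _ = (1 - s) * (3 * κ * V₀ / (3 + κ * H₀) * μ)
          * (min (V₀ / H₀ ^ 2) (2 / V₁) * (h ^ 2 + v ^ 2)) := by ring
      _ ≤ _ := by gcongr
  linarith

end IsSteadyState

/-! ### Uniformity for small viscosity -/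

theorem eventually_mul_lt (A : ℝ) {B : ℝ} (hB : 0 < B) :
    ∀ᶠ μ : ℝ in nhdsWithin 0 (Set.Ioi 0), A * μ < B := by
  have : Filter.Tendsto (fun μ : ℝ => A * μ) (nhds 0) (nhds (A * 0)) :=
    (continuous_const.mul continuous_id).tendsto 0
  rw [mul_zero] at this
  exact (this.eventually (gt_mem_nhds hB)).filter_mono nhdsWithin_le_nhds

/-- Bounds on subcritical steady states which are uniform for small viscosity. -/
theorem exists_uniform_bounds {g κ L H₀ V₀ : ℝ}
    (hg : 0 < g) (hκ : 0 < κ) (hL : 0 < L) (hH₀ : 0 < H₀) (hV₀ : 0 < V₀)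
    (hsub : V₀ ^ 2 < g * H₀) (hsteady : g * H₀ < (2 + √2) * V₀ ^ 2) :
    ∃ V₁ H₁ K c : ℝ, V₀ ≤ V₁ ∧ 0 < H₁ ∧ 0 < K ∧ 0 < c ∧
      ∀ᶠ μ : ℝ in nhdsWithin 0 (Set.Ioi 0), ∀ H V : ℝ → ℝ,
        IsSteadyState g κ μ L H₀ V₀ H V → ∀ x ∈ Set.Icc 0 L,
          V₀ ≤ V x ∧ V x ≤ V₁ ∧ H₁ ≤ H x ∧ H x ≤ H₀ ∧
          g / 2 ≤ weight g μ L H V x ∧ weight g μ L H V x ≤ g ∧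
          g - weight g μ L H V x ≤ K * μ ^ 2 ∧
          ∀ h v : ℝ, interiorForm g κ μ L H V x h v ≤ -(c * μ * (h ^ 2 + v ^ 2)) := by
  have hm : 0 < H₀ * V₀ := by positivity
  -- By mass conservation `V² < gH` reads `V³ < g H₀ V₀`; `V₁` is chosen between `V₀` and the
  -- critical velocity.
  obtain ⟨V₁, hV₁, hcrit⟩ : ∃ V₁, V₀ < V₁ ∧ V₁ ^ 3 < g * (H₀ * V₀) := by
    have h1 : V₀ ^ 3 < g * (H₀ * V₀) := by nlinarith
    have h2 : ∀ᶠ y in nhdsWithin V₀ (Set.Ioi V₀), y ^ 3 < g * (H₀ * V₀) :=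
      ((continuous_pow 3).tendsto V₀ |>.eventually (gt_mem_nhds h1)).filter_mono
        nhdsWithin_le_nhds
    obtain ⟨y, hy, hy'⟩ := (h2.and self_mem_nhdsWithin).exists
    exact ⟨y, hy', hy⟩
  have hV₁0 : 0 < V₁ := hV₀.trans hV₁
  have hd : 0 < g * (H₀ * V₀) - V₁ ^ 3 := by linarith
  obtain ⟨s, hs0, hs1, hratio⟩ := exists_ratio_lt_one (r := g * H₀ / V₀ ^ 2 - 1)
    (by rw [sub_pos, lt_div_iff₀ (by positivity)]; linarith)
    (by rw [sub_lt_iff_lt_add, div_lt_iff₀ (by positivity)]; linarith)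
  set C := 3 * V₁ ^ 4 / (H₀ * V₀ * (g * (H₀ * V₀) - V₁ ^ 3)) with hC
  have hC0 : 0 < C := by positivity
  have hH₁ : 0 < H₀ * V₀ / V₁ := by positivity
  refine ⟨V₁, H₀ * V₀ / V₁, 4 * C / (H₀ * V₀ / V₁) ^ 2,
    (1 - s) * (3 * κ * V₀ / (3 + κ * H₀)) * min (V₀ / H₀ ^ 2) (2 / V₁), hV₁.le, hH₁,
    by positivity, ?_, ?_⟩
  · have : 0 < 1 - s := by linarith
    have : 0 < min (V₀ / H₀ ^ 2) (2 / V₁) := lt_min (by positivity) (by positivity)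
    positivity
  have hmem : ∀ᶠ μ : ℝ in nhdsWithin 0 (Set.Ioi 0), 0 < μ := self_mem_nhdsWithin
  -- The last three conditions serve, in order, `V_le`, the hypothesis `hsmall` of
  -- `interiorForm_le`, and `weight ≥ g / 2`.
  filter_upwards [hmem, eventually_mul_lt 1 one_pos,
    eventually_mul_lt (3 * V₁ ^ 5 / ((H₀ * V₀) ^ 2 * (g * (H₀ * V₀) - V₁ ^ 3)) * L)
      (sub_pos.2 hV₁),
    eventually_mul_lt (4 * C * V₁ ^ 2) (mul_pos hm hd),
    eventually_mul_lt (4 * C / (H₀ * V₀ / V₁) ^ 2) (half_pos hg)]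
    with μ hμ hμ1 hsmall1 hsmall2 hsmall3 H V hs x hx
  have hμ1 : μ ≤ 1 := by linarith
  have hμμ : μ ^ 2 ≤ μ := by nlinarith
  have hVx := hs.V_le hL hκ hμ hg hH₀ hV₀ hV₁ hcrit (by linarith) hx
  have hHx := hs.le_H hx hVx
  have hw := hs.stress_le hL hκ hμ hg hH₀ hV₀ hcrit hx hVx
  have hw0 := hs.stress_nonneg hL hκ hμ x hx
  have hH := hs.pos_H x hx
  have hV := hs.pos_V x hx
  rw [← hC] at hw
  have hwμ : 4 * μ * stress L H V x ≤ 4 * C * μ ^ 2 := by nlinarith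
  have hwt := hs.weight_eq hx
  have hle : 4 * μ * stress L H V x / H x ^ 2 ≤ 4 * C / (H₀ * V₀ / V₁) ^ 2 * μ ^ 2 := by
    rw [div_mul_eq_mul_div]
    gcongr
  have hle' : 4 * C / (H₀ * V₀ / V₁) ^ 2 * μ ^ 2 ≤ 4 * C / (H₀ * V₀ / V₁) ^ 2 * μ := by gcongr
  have hnn : 0 ≤ 4 * μ * stress L H V x / H x ^ 2 := by positivity
  refine ⟨hs.V₀_le hL hκ hμ hx, hVx, hHx, hs.le_H₀ hL hκ hμ hV₀ hx, by linarith, by linarith,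
    by linarith, hs.interiorForm_le hL hκ hμ hg hs0 hs1.le hμ1 hV₀ hratio hx hVx ?_⟩
  have h1 : (g * H x / V x - V x) * (H x * V x) * V x ^ 2
      = (H x * V x) * (g * (H x * V x) - V x ^ 3) := by field_simp
  have h2 : 4 * μ * stress L H V x * V x ^ 2
      ≤ (g * H x / V x - V x) * (H x * V x) * V x ^ 2 := by
    rw [h1, hs.mul_eq hx]
    calc 4 * μ * stress L H V x * V x ^ 2 ≤ 4 * C * μ ^ 2 * V₁ ^ 2 := by gcongr
      _ ≤ 4 * C * μ * V₁ ^ 2 := by gcongr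
      _ = 4 * C * V₁ ^ 2 * μ := by ring
      _ ≤ H₀ * V₀ * (g * (H₀ * V₀) - V₁ ^ 3) := hsmall2.le
      _ ≤ _ := by gcongr
  exact le_of_mul_le_mul_right h2 (by positivity)

/-! ### Calculus for absolutely continuous functions -/

theorem _root_.AbsolutelyContinuousOnInterval.congr {X : Type*} [PseudoMetricSpace X]
    {f f' : ℝ → X} {a b : ℝ} (hf : AbsolutelyContinuousOnInterval f a b)
    (h : Set.EqOn f f' (Set.uIcc a b)) : AbsolutelyContinuousOnInterval f' a b := by
  rw [absolutelyContinuousOnInterval_iff] at hf ⊢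
  intro ε hε
  obtain ⟨δ, hδ, hE⟩ := hf ε hε
  refine ⟨δ, hδ, fun E hEd hEl => ?_⟩
  rw [Finset.sum_congr rfl fun i hi => by rw [← h (hEd.1 i hi).1, ← h (hEd.1 i hi).2]]
  exact hE E hEd hEl

/-- A differential inequality for an absolutely continuous function, integrated. -/
theorem _root_.AbsolutelyContinuousOnInterval.setIntegral_Ioo_le {Φ F : ℝ → ℝ} {L : ℝ}
    (hL : 0 ≤ L) (hΦ : AbsolutelyContinuousOnInterval Φ 0 L)
    (hF : Integrable F (volume.restrict (Set.Ioo 0 L)))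
    (hle : ∀ᵐ x ∂(volume.restrict (Set.Ioo 0 L)), ∃ d, HasDerivAt Φ d x ∧ F x ≤ -d) :
    ∫ x in Set.Ioo 0 L, F x ≤ Φ 0 - Φ L := by
  have h1 := hΦ.integral_deriv_eq_sub
  rw [intervalIntegral.integral_of_le hL, integral_Ioc_eq_integral_Ioo] at h1
  have h2 : Integrable (deriv Φ) (volume.restrict (Set.Ioo 0 L)) :=
    ((intervalIntegrable_iff_integrableOn_Ioo_of_le hL).1 hΦ.intervalIntegrable_deriv)
  calc ∫ x in Set.Ioo 0 L, F x ≤ ∫ x in Set.Ioo 0 L, -deriv Φ x := by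
        apply integral_mono_ae hF h2.neg
        filter_upwards [hle] with x ⟨d, hd, hx⟩
        rw [Pi.neg_apply, hd.deriv]; exact hx
    _ = Φ 0 - Φ L := by rw [integral_neg, h1]; ring

theorem _root_.ContDiffOn.absolutelyContinuousOnInterval_Icc {u : ℝ → ℝ} {L : ℝ} (hL : 0 ≤ L)
    (hu : ContDiffOn ℝ 1 u (Set.Icc 0 L)) : AbsolutelyContinuousOnInterval u 0 L :=
  ContDiffOn.absolutelyContinuousOnInterval (by rwa [Set.uIcc_of_le hL])

namespace HasH1Deriv

variable {L : ℝ} {u u' : ℝ → ℝ}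

theorem intervalIntegrable (hu : HasH1Deriv L u u') (hL : 0 ≤ L) :
    IntervalIntegrable u' volume 0 L :=
  (intervalIntegrable_iff_integrableOn_Ioo_of_le hL).2 (hu.1.integrable (by norm_num))

theorem absolutelyContinuousOnInterval (hu : HasH1Deriv L u u') (hL : 0 ≤ L) :
    AbsolutelyContinuousOnInterval u 0 L := by
  have h1 := (hu.intervalIntegrable hL).absolutelyContinuousOnInterval_intervalIntegral
    (c := 0) (by simp)
  have h2 : AbsolutelyContinuousOnInterval (fun _ : ℝ => u 0) 0 L :=
    contDiffOn_const.absolutelyContinuousOnInterval_Icc hL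
  refine (h2.fun_add h1).congr fun x hx => ?_
  rw [Set.uIcc_of_le hL] at hx
  exact (hu.2 x hx).symm

theorem ae_hasDerivAt (hu : HasH1Deriv L u u') (hL : 0 ≤ L) :
    ∀ᵐ x ∂(volume.restrict (Set.Ioo 0 L)), HasDerivAt u (u' x) x := by
  rw [ae_restrict_iff' measurableSet_Ioo]
  filter_upwards [(hu.intervalIntegrable hL).ae_hasDerivAt_integral] with x hx hxL
  have h1 := (hx (by rw [Set.uIcc_of_le hL]; exact ⟨hxL.1.le, hxL.2.le⟩) 0 (by simp)).const_add
    (u 0)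
  refine h1.congr_of_eventuallyEq ?_
  filter_upwards [Ioo_mem_nhds hxL.1 hxL.2] with y hy
  exact hu.2 y ⟨hy.1.le, hy.2.le⟩

end HasH1Deriv

/-! ### Energy inequality -/

/-- The energy flux, with an additional term which controls the trace of the velocity. -/
def flux (g μ L : ℝ) (H V : ℝ → ℝ) (e : ℝ) (h v vx : ℝ → ℝ) (x : ℝ) : ℝ :=
  weight g μ L H V x * V x * (h x * h x) + 2 * (weight g μ L H V x * H x * (h x * v x))
    + H x * V x * (v x * v x) - 8 * μ * (H x * (v x * vx x)) + e * (x * (v x * v x))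

namespace IsSteadyState

variable {g κ μ L H₀ V₀ : ℝ} {H V : ℝ → ℝ}

theorem absolutelyContinuousOnInterval_flux (hs : IsSteadyState g κ μ L H₀ V₀ H V) (hL : 0 < L)
    (e : ℝ) {h hx v vx vxx : ℝ → ℝ} (hh : HasH1Deriv L h hx) (hv : HasH1Deriv L v vx)
    (hvx : HasH1Deriv L vx vxx) :
    AbsolutelyContinuousOnInterval (flux g μ L H V e h v vx) 0 L := by
  have hp := (hs.contDiffOn_weight hL).absolutelyContinuousOnInterval_Icc hL.le
  have hH := (hs.contDiff_H.of_le (by norm_num : (1 : WithTop ℕ∞) ≤ 2)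
    ).absolutelyContinuousOnInterval_Icc hL.le
  have hV := (hs.contDiff_V.of_le (by norm_num : (1 : WithTop ℕ∞) ≤ 2)
    ).absolutelyContinuousOnInterval_Icc hL.le
  have hid := (contDiffOn_id (𝕜 := ℝ) (n := 1) (s := Set.Icc 0 L)
    ).absolutelyContinuousOnInterval_Icc hL.le
  have ah := hh.absolutelyContinuousOnInterval hL.le
  have av := hv.absolutelyContinuousOnInterval hL.le
  have avx := hvx.absolutelyContinuousOnInterval hL.le
  exact (((((hp.fun_mul hV).fun_mul (ah.fun_mul ah)).fun_add
    (((hp.fun_mul hH).fun_mul (ah.fun_mul av)).const_mul 2)).fun_add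
    ((hH.fun_mul hV).fun_mul (av.fun_mul av))).fun_sub
    ((hH.fun_mul (av.fun_mul avx)).const_mul (8 * μ))).fun_add
    ((hid.fun_mul (av.fun_mul av)).const_mul e)

theorem energy_inequality (hs : IsSteadyState g κ μ L H₀ V₀ H V) (hL : 0 < L) (hμ : 0 < μ)
    {c e H₁ : ℝ} (he : 0 ≤ e) (he₁ : e * (1 + L) ≤ c / 2) (he₂ : e * L ≤ 8 * μ * H₁)
    (hH₁ : ∀ x ∈ Set.Icc 0 L, H₁ ≤ H x)
    (hform : ∀ x ∈ Set.Icc 0 L, ∀ h v : ℝ,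
      interiorForm g κ μ L H V x h v ≤ -(c * (h ^ 2 + v ^ 2)))
    {h hx v vx vxx ht vt : ℝ → ℝ} (hh : HasH1Deriv L h hx) (hv : HasH1Deriv L v vx)
    (hvx : HasH1Deriv L vx vxx)
    (heq₁ : ∀ᵐ x ∂(volume.restrict (Set.Ioo 0 L)),
      ht x + (V x * hx x + H x * vx x) + (dx L V x * h x + dx L H x * v x) = 0)
    (heq₂ : ∀ᵐ x ∂(volume.restrict (Set.Ioo 0 L)),
      -4 * μ * vxx x + vt x
        + (weight g μ L H V x * hx x + (V x - 4 * μ * (dx L H x / H x)) * vx x)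
        + (matC κ μ L H V x 1 0 * h x + matC κ μ L H V x 1 1 * v x) = 0)
    (hint : Integrable (fun x => 2 * (weight g μ L H V x * (h x * ht x) + H x * (v x * vt x))
      + c / 2 * (h x ^ 2 + v x ^ 2)) (volume.restrict (Set.Ioo 0 L))) :
    ∫ x in Set.Ioo 0 L, (2 * (weight g μ L H V x * (h x * ht x) + H x * (v x * vt x))
      + c / 2 * (h x ^ 2 + v x ^ 2))
      ≤ flux g μ L H V e h v vx 0 - flux g μ L H V e h v vx L := by
  refine (hs.absolutelyContinuousOnInterval_flux hL e hh hv hvx).setIntegral_Ioo_le hL.le hint ?_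
  filter_upwards [heq₁, heq₂, hh.ae_hasDerivAt hL.le, hv.ae_hasDerivAt hL.le,
    hvx.ae_hasDerivAt hL.le, ae_restrict_mem measurableSet_Ioo] with x h1 h2 dh dv dvx hx0
  have hxI : x ∈ Set.Icc 0 L := ⟨hx0.1.le, hx0.2.le⟩
  have hnhds : Set.Icc 0 L ∈ nhds x := Icc_mem_nhds hx0.1 hx0.2
  have dp := (hs.hasDerivWithinAt_weight hL hμ hxI).hasDerivAt hnhds
  have dH := (hs.hasDerivWithinAt_H hxI).hasDerivAt hnhds
  have dV := (hs.hasDerivWithinAt_V hxI).hasDerivAt hnhds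
  refine ⟨_, (((((dp.fun_mul dV).fun_mul (dh.fun_mul dh)).fun_add
    (((dp.fun_mul dH).fun_mul (dh.fun_mul dv)).const_mul 2)).fun_add
    ((dH.fun_mul dV).fun_mul (dv.fun_mul dv))).fun_sub
    ((dH.fun_mul (dv.fun_mul dvx)).const_mul (8 * μ))).fun_add
    (((hasDerivAt_id x).fun_mul (dv.fun_mul dv)).const_mul e), ?_⟩
  have hH := hs.pos_H x hxI
  have hmass : dx L H x * V x = -(H x * dx L V x) := hs.dx_mass hL hxI
  have hf := hform x hxI (h x) (v x)
  rw [interiorForm] at hf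
  have hHH := hH₁ x hxI
  have e1 : ht x = -((V x * hx x + H x * vx x) + (dx L V x * h x + dx L H x * v x)) := by
    linarith
  have e2 : H x * vt x = H x * (4 * μ * vxx x) - H x * (weight g μ L H V x * hx x)
      - H x * V x * vx x + 4 * μ * (dx L H x * vx x)
      - H x * (matC κ μ L H V x 1 0 * h x + matC κ μ L H V x 1 1 * v x) := by
    have : H x * (4 * μ * (dx L H x / H x) * vx x) = 4 * μ * (dx L H x * vx x) := by field_simp
    linear_combination H x * h2 + this
  -- The extra flux term has derivative `e v² + 2 e x v v_x`. Its `v²` part is paid by half of the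
  -- interior decay (`t2`), its `v_x²` part by the viscous dissipation (`t3`).
  have t1 : e * (2 * x * (v x * vx x)) ≤ e * (L * (v x ^ 2 + vx x ^ 2)) := by
    refine mul_le_mul_of_nonneg_left ?_ he
    calc 2 * x * (v x * vx x) = x * (2 * v x * vx x) := by ring
      _ ≤ x * (v x ^ 2 + vx x ^ 2) := by
        have := hx0.1.le
        gcongr
        exact two_mul_le_add_sq _ _
      _ ≤ _ := by have := hx0.2.le; gcongr
  have t2 : e * (1 + L) * v x ^ 2 ≤ c / 2 * v x ^ 2 := by gcongr
  have t3 : e * L * vx x ^ 2 ≤ 8 * μ * H x * vx x ^ 2 := by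
    refine (mul_le_mul_of_nonneg_right he₂ (sq_nonneg _)).trans ?_
    gcongr
  have t4 : 0 ≤ c / 2 * h x ^ 2 := by
    have : 0 ≤ c / 2 := le_trans (by positivity) he₁
    positivity
  simp only [id]
  rw [e1, show H x * (v x * vt x) = v x * (H x * vt x) by ring, e2]
  linear_combination hf + t1 + t2 + t3 + t4 + (v x * v x) * hmass

end IsSteadyState

/-! ### The Lyapunov function as a bounded bilinear form -/

namespace L2

variable {L : ℝ}

theorem memLp_apply (y : L2 L) (i : Fin 2) :
    MemLp (fun x => y x i) 2 (volume.restrict (Set.Ioo 0 L)) :=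
  (EuclideanSpace.proj (𝕜 := ℝ) i).comp_memLp' (Lp.memLp y)

theorem integrable_weighted_mul {q : ℝ → ℝ} {M : ℝ}
    (hq : AEStronglyMeasurable q (volume.restrict (Set.Ioo 0 L)))
    (hM : ∀ x ∈ Set.Ioo 0 L, |q x| ≤ M) (y z : L2 L) (i : Fin 2) :
    Integrable (fun x => q x * (y x i * z x i)) (volume.restrict (Set.Ioo 0 L)) := by
  refine ((memLp_apply y i).integrable_mul (memLp_apply z i)).bdd_mul (c := M) hq ?_
  filter_upwards [ae_restrict_mem measurableSet_Ioo] with x hx using hM x hx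

theorem integral_norm_mul_norm_le (y z : L2 L) :
    ∫ x in Set.Ioo 0 L, ‖y x‖ * ‖z x‖ ≤ ‖y‖ * ‖z‖ := by
  have hy := (Lp.memLp y).norm
  have hz := (Lp.memLp z).norm
  have h1 := real_inner_le_norm (hy.toLp) (hz.toLp)
  rw [Lp.norm_toLp, Lp.norm_toLp, eLpNorm_norm, eLpNorm_norm, ← Lp.norm_def, ← Lp.norm_def,
    MeasureTheory.L2.inner_def] at h1
  refine le_trans (le_of_eq (integral_congr_ae ?_)) h1
  filter_upwards [hy.coeFn_toLp, hz.coeFn_toLp] with x h2 h3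
  rw [h2, h3]
  simp [mul_comm]

theorem norm_sq_eq (y : L2 L) :
    ‖y‖ ^ 2 = ∫ x in Set.Ioo 0 L, (y x 0 ^ 2 + y x 1 ^ 2) := by
  rw [← real_inner_self_eq_norm_sq, MeasureTheory.L2.inner_def]
  refine integral_congr_ae (Filter.Eventually.of_forall fun x => ?_)
  simp only [real_inner_self_eq_norm_sq, EuclideanSpace.real_norm_sq_eq, Fin.sum_univ_two]

/-- A pair of bounded weights defines a continuous bilinear form on `L²((0, L); ℝ²)`. -/
theorem exists_weighted_form {q₁ q₂ : ℝ → ℝ} {M : ℝ} (hM : 0 ≤ M)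
    (hq₁ : AEStronglyMeasurable q₁ (volume.restrict (Set.Ioo 0 L)))
    (hq₂ : AEStronglyMeasurable q₂ (volume.restrict (Set.Ioo 0 L)))
    (hM₁ : ∀ x ∈ Set.Ioo 0 L, |q₁ x| ≤ M) (hM₂ : ∀ x ∈ Set.Ioo 0 L, |q₂ x| ≤ M) :
    ∃ B : L2 L →L[ℝ] L2 L →L[ℝ] ℝ, ∀ y z, B y z =
      ∫ x in Set.Ioo 0 L, (q₁ x * (y x 0 * z x 0) + q₂ x * (y x 1 * z x 1)) := by
  have hint : ∀ y z : L2 L, Integrable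
      (fun x => q₁ x * (y x 0 * z x 0) + q₂ x * (y x 1 * z x 1))
      (volume.restrict (Set.Ioo 0 L)) := fun y z =>
    (integrable_weighted_mul hq₁ hM₁ y z 0).add (integrable_weighted_mul hq₂ hM₂ y z 1)
  refine ⟨LinearMap.mkContinuous₂ (LinearMap.mk₂ ℝ (fun y z : L2 L =>
    ∫ x in Set.Ioo 0 L, (q₁ x * (y x 0 * z x 0) + q₂ x * (y x 1 * z x 1))) ?_ ?_ ?_ ?_)
    (2 * M) ?_, fun y z => rfl⟩
  · intro y y' z
    rw [← integral_add (hint y z) (hint y' z)]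
    refine integral_congr_ae ?_
    filter_upwards [Lp.coeFn_add y y'] with x hx
    simp only [hx, Pi.add_apply, PiLp.add_apply]
    ring
  · intro a y z
    rw [smul_eq_mul, ← integral_const_mul]
    refine integral_congr_ae ?_
    filter_upwards [Lp.coeFn_smul a y] with x hx
    simp only [hx, Pi.smul_apply, PiLp.smul_apply, smul_eq_mul]
    ring
  · intro y z z'
    rw [← integral_add (hint y z) (hint y z')]
    refine integral_congr_ae ?_
    filter_upwards [Lp.coeFn_add z z'] with x hx
    simp only [hx, Pi.add_apply, PiLp.add_apply]
    ring
  · intro a y z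
    rw [smul_eq_mul, ← integral_const_mul]
    refine integral_congr_ae ?_
    filter_upwards [Lp.coeFn_smul a z] with x hx
    simp only [hx, Pi.smul_apply, PiLp.smul_apply, smul_eq_mul]
    ring
  · intro y z
    rw [LinearMap.mk₂_apply]
    have hnn : Integrable (fun x => 2 * M * (‖y x‖ * ‖z x‖))
        (volume.restrict (Set.Ioo 0 L)) :=
      ((Lp.memLp y).norm.integrable_mul (Lp.memLp z).norm).const_mul _
    calc ‖∫ x in Set.Ioo 0 L, (q₁ x * (y x 0 * z x 0) + q₂ x * (y x 1 * z x 1))‖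
        ≤ ∫ x in Set.Ioo 0 L, 2 * M * (‖y x‖ * ‖z x‖) := by
          apply norm_integral_le_of_norm_le hnn
          filter_upwards [ae_restrict_mem measurableSet_Ioo] with x hx
          have h1 := hM₁ x hx
          have h2 := hM₂ x hx
          have n1 : ∀ (u : EuclideanSpace ℝ (Fin 2)) (i : Fin 2), |u i| ≤ ‖u‖ := fun u i =>
            PiLp.norm_apply_le u i
          calc ‖q₁ x * (y x 0 * z x 0) + q₂ x * (y x 1 * z x 1)‖
              ≤ ‖q₁ x * (y x 0 * z x 0)‖ + ‖q₂ x * (y x 1 * z x 1)‖ := norm_add_le _ _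
            _ = |q₁ x| * (|y x 0| * |z x 0|) + |q₂ x| * (|y x 1| * |z x 1|) := by
              simp only [norm_mul, Real.norm_eq_abs]
            _ ≤ M * (‖y x‖ * ‖z x‖) + M * (‖y x‖ * ‖z x‖) := by
              gcongr <;> apply n1
            _ = _ := by ring
      _ = 2 * M * ∫ x in Set.Ioo 0 L, ‖y x‖ * ‖z x‖ := integral_const_mul _ _
      _ ≤ 2 * M * (‖y‖ * ‖z‖) := by
        gcongr
        exact integral_norm_mul_norm_le y z
      _ = 2 * M * ‖y‖ * ‖z‖ := by ring

end L2

theorem lyapunov_eq (g μ L : ℝ) (H V : ℝ → ℝ) (y : L2 L) :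
    lyapunov g μ L H V y = ∫ x in Set.Ioo 0 L,
      ((1 + μ) * weight g μ L H V x * (y x 0 * y x 0) + (1 + μ) * H x * (y x 1 * y x 1)) := by
  rw [lyapunov]
  congr 1
  ext x
  simp only [matQ, qTilde₁, qTilde₂, weight, Matrix.mulVec_diagonal, dotProduct, Fin.sum_univ_two,
    Matrix.cons_val_zero, Matrix.cons_val_one]
  ring

/-- The Lyapunov function is the quadratic form of a continuous bilinear form, and is equivalent to
the square of the norm. -/
theorem lyapunov_properties {g μ L H₀ H₁ : ℝ} {H V : ℝ → ℝ} (hg : 0 < g) (hμ : 0 < μ)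
    (hH₁ : 0 < H₁)
    (hp : ContinuousOn (weight g μ L H V) (Set.Icc 0 L)) (hH : ContinuousOn H (Set.Icc 0 L))
    (hbd : ∀ x ∈ Set.Icc 0 L, H₁ ≤ H x ∧ H x ≤ H₀ ∧ g / 2 ≤ weight g μ L H V x ∧
      weight g μ L H V x ≤ g) :
    (∃ B : L2 L →L[ℝ] L2 L →L[ℝ] ℝ,
      (∀ y, lyapunov g μ L H V y = B y y) ∧ ∀ y z, B y z = ∫ x in Set.Ioo 0 L,
        ((1 + μ) * weight g μ L H V x * (y x 0 * z x 0) + (1 + μ) * H x * (y x 1 * z x 1))) ∧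
    (∀ y z : L2 L, Integrable (fun x => (1 + μ) * weight g μ L H V x * (y x 0 * z x 0)
      + (1 + μ) * H x * (y x 1 * z x 1)) (volume.restrict (Set.Ioo 0 L))) ∧
    ∀ y : L2 L, (1 + μ) * min (g / 2) H₁ * ‖y‖ ^ 2 ≤ lyapunov g μ L H V y ∧
      lyapunov g μ L H V y ≤ (1 + μ) * max g H₀ * ‖y‖ ^ 2 := by
  have m1 : AEStronglyMeasurable (fun x => (1 + μ) * weight g μ L H V x)
      (volume.restrict (Set.Ioo 0 L)) :=
    ((hp.mono Set.Ioo_subset_Icc_self).aestronglyMeasurable measurableSet_Ioo).const_mul _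
  have m2 : AEStronglyMeasurable (fun x => (1 + μ) * H x)
      (volume.restrict (Set.Ioo 0 L)) :=
    ((hH.mono Set.Ioo_subset_Icc_self).aestronglyMeasurable measurableSet_Ioo).const_mul _
  have b1 : ∀ x ∈ Set.Ioo 0 L, |(1 + μ) * weight g μ L H V x| ≤ (1 + μ) * max g H₀ := by
    intro x hx
    obtain ⟨-, -, h3, h4⟩ := hbd x (Set.Ioo_subset_Icc_self hx)
    have : 0 ≤ weight g μ L H V x := by linarith
    rw [abs_of_nonneg (by positivity)]
    gcongr
    exact h4.trans (le_max_left _ _)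
  have b2 : ∀ x ∈ Set.Ioo 0 L, |(1 + μ) * H x| ≤ (1 + μ) * max g H₀ := by
    intro x hx
    obtain ⟨h1, h2, -, -⟩ := hbd x (Set.Ioo_subset_Icc_self hx)
    have : 0 ≤ H x := by linarith
    rw [abs_of_nonneg (by positivity)]
    gcongr
    exact h2.trans (le_max_right _ _)
  have hint : ∀ y z : L2 L, Integrable (fun x => (1 + μ) * weight g μ L H V x * (y x 0 * z x 0)
      + (1 + μ) * H x * (y x 1 * z x 1)) (volume.restrict (Set.Ioo 0 L)) := fun y z =>
    (L2.integrable_weighted_mul m1 b1 y z 0).add (L2.integrable_weighted_mul m2 b2 y z 1)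
  refine ⟨?_, hint, fun y => ?_⟩
  · obtain ⟨B, hB⟩ := L2.exists_weighted_form (by positivity) m1 m2 b1 b2
    exact ⟨B, fun y => by rw [hB, lyapunov_eq], hB⟩
  · have hsq : Integrable (fun x => y x 0 ^ 2 + y x 1 ^ 2) (volume.restrict (Set.Ioo 0 L)) :=
      (L2.memLp_apply y 0).integrable_sq.add (L2.memLp_apply y 1).integrable_sq
    rw [lyapunov_eq, L2.norm_sq_eq, ← integral_const_mul, ← integral_const_mul]
    constructor
    · refine integral_mono_ae (hsq.const_mul _) (hint y y) ?_
      filter_upwards [ae_restrict_mem measurableSet_Ioo] with x hx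
      obtain ⟨h1, -, h3, -⟩ := hbd x (Set.Ioo_subset_Icc_self hx)
      rw [mul_add, ← sq, ← sq]
      gcongr
      · exact (min_le_left _ _).trans h3
      · exact (min_le_right _ _).trans h1
    · refine integral_mono_ae (hint y y) (hsq.const_mul _) ?_
      filter_upwards [ae_restrict_mem measurableSet_Ioo] with x hx
      obtain ⟨-, h2, -, h4⟩ := hbd x (Set.Ioo_subset_Icc_self hx)
      rw [mul_add, ← sq, ← sq]
      gcongr
      · exact h4.trans (le_max_left _ _)
      · exact h2.trans (le_max_right _ _)

/-! ### Boundary terms and decay -/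

/-- For small viscosity, the boundary conditions make the flux at the outflow end nonnegative. -/
theorem eventually_outflow_nonneg {g L H₀ V₀ V₁ H₁ K : ℝ} (b₁ c₁ : ℝ) {e : ℝ}
    (hg : 0 < g) (hL : 0 < L) (hH₀ : 0 < H₀) (hV₀ : 0 < V₀) (hV₁ : V₀ ≤ V₁) (hH₁ : 0 < H₁)
    (hK : 0 < K) (he : 0 < e) :
    ∀ᶠ μ : ℝ in nhdsWithin 0 (Set.Ioi 0), ∀ (H V h v vx : ℝ → ℝ) (b₀ : ℝ),
      H₁ ≤ H L → H L ≤ H₀ → V₀ ≤ V L → V L ≤ V₁ → V L ^ 2 < g * H L →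
      weight g μ L H V L ≤ g → g - weight g μ L H V L ≤ K * μ ^ 2 →
      BoundaryCondition g L b₀ b₁ c₁ H V → v L = b₁ * h L + μ * c₁ * vx L →
      0 ≤ flux g μ L H V (e * μ) h v vx L := by
  -- `D` bounds the square of the coefficient `β` of `outflow_form_nonneg`, uniformly in the steady
  -- state.
  set D := (H₀ * (g + 4 * |b₁ / c₁|) / (g * V₀)) ^ 2 with hD
  have hD0 : 0 ≤ D := sq_nonneg _
  have hmem : ∀ᶠ μ : ℝ in nhdsWithin 0 (Set.Ioi 0), 0 < μ := self_mem_nhdsWithin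
  filter_upwards [hmem, eventually_mul_lt 1 one_pos,
    eventually_mul_lt (K * (2 * (V₁ + H₀))) (mul_pos hg hV₀),
    eventually_mul_lt (K * (2 * (V₁ + H₀) * D + H₀)) (mul_pos he hL)]
    with μ hμ hμ1 hs1 hs2 H V h v vx b₀ hHL hHL' hVL hVL' hsub hwt hwt' hbc hv
  have hH : 0 < H L := hH₁.trans_le hHL
  have hV : 0 < V L := hV₀.trans_le hVL
  have hV₁0 : 0 < V₁ := hV₀.trans_le hV₁
  have hβ : (H L * (g + 4 * (b₁ / c₁)) / (g * V L)) ^ 2 ≤ D := by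
    rw [hD]
    have h1 : |g + 4 * (b₁ / c₁)| ≤ g + 4 * |b₁ / c₁| := by
      have := neg_abs_le (b₁ / c₁)
      have := le_abs_self (b₁ / c₁)
      rw [abs_le]; constructor <;> linarith
    rw [← sq_abs, abs_div, abs_mul, abs_of_pos hH, abs_of_pos (mul_pos hg hV)]
    gcongr
  have hδ : 0 ≤ g - weight g μ L H V L := by linarith
  have hμμ : K * μ ^ 2 ≤ K * μ := by
    gcongr
    nlinarith
  have key := outflow_form_nonneg (δ := g - weight g μ L H V L) (e := e * μ * L) (ζ := μ * vx L)
    hg hH hV (outflow_coefficient_ne_zero hg hH hsub hbc) (outflow_discriminant hg hsub hbc).le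
    (show v L = b₁ * h L + c₁ * (μ * vx L) by rw [hv]; ring) hδ
    (by
      calc (g - weight g μ L H V L) * (2 * (V L + H L))
          ≤ (K * μ) * (2 * (V₁ + H₀)) := by
            gcongr
            exact hwt'.trans hμμ
        _ ≤ g * V₀ := by linarith
        _ ≤ g * V L := by gcongr)
    (by
      calc (g - weight g μ L H V L) *
            (2 * (V L + H L) * (H L * (g + 4 * (b₁ / c₁)) / (g * V L)) ^ 2 + H L)
          ≤ (K * μ ^ 2) * (2 * (V₁ + H₀) * D + H₀) := by gcongr
        _ = K * (2 * (V₁ + H₀) * D + H₀) * μ * μ := by ring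
        _ ≤ e * L * μ := by gcongr
        _ = e * μ * L := by ring)
  rw [flux]
  linear_combination key

/-- No smallness is needed here: `V_x(0) = 0` makes the weight equal to `g`, and both the viscous
and the trace terms vanish at `x = 0`. -/
theorem flux_zero_nonpos {g μ L b₀ b₁ c₁ e : ℝ} {H V h v vx : ℝ → ℝ} (hg : 0 < g) (hH : 0 < H 0)
    (hV : 0 < V 0) (hVx : dx L V 0 = 0) (hbc : BoundaryCondition g L b₀ b₁ c₁ H V)
    (hv : v 0 = -b₀ * h 0) (hvx : vx 0 = 0) : flux g μ L H V e h v vx 0 ≤ 0 := by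
  have := inflow_form_nonpos hg hH hV hbc (h 0)
  simp only [flux, weight, hVx, hvx, hv]
  linear_combination this

/-- Decay of the Lyapunov function along the solutions, for a fixed steady state. -/
theorem lyapunov_decay {g κ μ L H₀ V₀ b₀ b₁ c₁ c e H₁ k : ℝ} {H V : ℝ → ℝ}
    (hs : IsSteadyState g κ μ L H₀ V₀ H V) (hg : 0 < g) (hL : 0 < L) (hμ : 0 < μ)
    (he : 0 ≤ e) (he₁ : e * (1 + L) ≤ c / 2) (he₂ : e * L ≤ 8 * μ * H₁) (hc : 0 < c) (hk : 0 < k)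
    (hH₁ : ∀ x ∈ Set.Icc 0 L, H₁ ≤ H x)
    (hform : ∀ x ∈ Set.Icc 0 L, ∀ h v : ℝ,
      interiorForm g κ μ L H V x h v ≤ -(c * (h ^ 2 + v ^ 2)))
    (hbc : BoundaryCondition g L b₀ b₁ c₁ H V)
    (hout : ∀ h v vx : ℝ → ℝ, v L = b₁ * h L + μ * c₁ * vx L → 0 ≤ flux g μ L H V e h v vx L)
    {B : L2 L →L[ℝ] L2 L →L[ℝ] ℝ} (hBy : ∀ y, lyapunov g μ L H V y = B y y)
    (hB : ∀ y z, B y z = ∫ x in Set.Ioo 0 L,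
      ((1 + μ) * weight g μ L H V x * (y x 0 * z x 0) + (1 + μ) * H x * (y x 1 * z x 1)))
    (hint : ∀ y z : L2 L, Integrable (fun x => (1 + μ) * weight g μ L H V x * (y x 0 * z x 0)
      + (1 + μ) * H x * (y x 1 * z x 1)) (volume.restrict (Set.Ioo 0 L)))
    (hupper : ∀ y, lyapunov g μ L H V y ≤ k * ‖y‖ ^ 2)
    {y : ℝ → L2 L} (hy : IsSolution g κ μ L b₀ b₁ c₁ H V y) {t : ℝ} (ht : 0 ≤ t) :
    ∃ W' : ℝ, HasDerivWithinAt (fun s => lyapunov g μ L H V (y s)) W' (Set.Ici 0) t ∧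
      W' ≤ -((1 + μ) * (c / 2) / k) * lyapunov g μ L H V (y t) := by
  set y' := derivWithin y (Set.Ici 0) t with hy'
  have hd : HasDerivWithinAt y y' (Set.Ici 0) t :=
    (hy.contDiff.differentiableOn one_ne_zero t ht).hasDerivWithinAt
  refine ⟨B (y t) y' + B y' (y t), ?_, ?_⟩
  · simp only [hBy]
    exact B.hasDerivWithinAt_of_bilinear hd hd
  obtain ⟨h, hx, v, vx, vxx, hh, hv, hvx, hyt, heq, hv0, hvL, hvx0⟩ := hy.eqn t ht
  have hsq : Integrable (fun x => y t x 0 ^ 2 + y t x 1 ^ 2) (volume.restrict (Set.Ioo 0 L)) :=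
    (L2.memLp_apply (y t) 0).integrable_sq.add (L2.memLp_apply (y t) 1).integrable_sq
  have hae : ∀ᵐ x ∂(volume.restrict (Set.Ioo 0 L)),
      (1 + μ) * (2 * (weight g μ L H V x * (h x * y' x 0) + H x * (v x * y' x 1))
        + c / 2 * (h x ^ 2 + v x ^ 2)) =
      ((1 + μ) * weight g μ L H V x * (y t x 0 * y' x 0) + (1 + μ) * H x * (y t x 1 * y' x 1))
      + ((1 + μ) * weight g μ L H V x * (y' x 0 * y t x 0) + (1 + μ) * H x * (y' x 1 * y t x 1))
      + (1 + μ) * (c / 2) * (y t x 0 ^ 2 + y t x 1 ^ 2) := by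
    filter_upwards [hyt] with x hx
    rw [hx]
    simp only [Matrix.cons_val_zero, Matrix.cons_val_one]
    ring
  have hμ1 : (1 + μ) ≠ 0 := by positivity
  have hadd : Integrable (fun x =>
      ((1 + μ) * weight g μ L H V x * (y t x 0 * y' x 0) + (1 + μ) * H x * (y t x 1 * y' x 1))
      + ((1 + μ) * weight g μ L H V x * (y' x 0 * y t x 0) + (1 + μ) * H x * (y' x 1 * y t x 1)))
      (volume.restrict (Set.Ioo 0 L)) := (hint (y t) y').add (hint y' (y t))
  have hI := (hadd.add
    (hsq.const_mul ((1 + μ) * (c / 2)))).congr (hae.mono fun x hx => hx.symm)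
  have hmul := integral_const_mul (μ := volume.restrict (Set.Ioo 0 L)) (1 + μ)
    (fun x => 2 * (weight g μ L H V x * (h x * y' x 0) + H x * (v x * y' x 1))
        + c / 2 * (h x ^ 2 + v x ^ 2))
  rw [integral_congr_ae hae, integral_add hadd
    (hsq.const_mul _), integral_add (hint (y t) y') (hint y' (y t)), ← hB, ← hB,
    integral_const_mul, ← L2.norm_sq_eq] at hmul
  have hen := hs.energy_inequality (ht := fun x => y' x 0) (vt := fun x => y' x 1) hL hμ he he₁ he₂
    hH₁ hform hh hv hvx
    (by
      filter_upwards [heq] with x hx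
      have := congrFun hx 0
      simp only [matA, matB, matC, Matrix.mulVec, dotProduct, Fin.sum_univ_two, Pi.add_apply,
        Matrix.of_apply, Matrix.cons_val', Matrix.cons_val_zero, Matrix.cons_val_one,
        Pi.zero_apply] at this
      linear_combination this)
    (by
      filter_upwards [heq] with x hx
      have := congrFun hx 1
      simp only [matA, matB, Matrix.mulVec, dotProduct, Fin.sum_univ_two, Pi.add_apply,
        Matrix.of_apply, Matrix.cons_val', Matrix.cons_val_zero, Matrix.cons_val_one,
        Pi.zero_apply] at this
      rw [weight]
      linear_combination this)
    ((integrable_const_mul_iff (isUnit_iff_ne_zero.2 hμ1) _).1 hI)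
  have hflux0 := flux_zero_nonpos (μ := μ) (L := L) (e := e) hg
    (hs.pos_H 0 ⟨le_rfl, hL.le⟩) (hs.pos_V 0 ⟨le_rfl, hL.le⟩) hs.dx_V_zero hbc hv0 hvx0
  have hfluxL := hout h v vx hvL
  have hneg := mul_nonpos_of_nonneg_of_nonpos (show 0 ≤ 1 + μ by linarith)
    (hen.trans (show _ ≤ (0 : ℝ) by linarith))
  rw [← hmul] at hneg
  have h1 : (1 + μ) * (c / 2) / k * lyapunov g μ L H V (y t) ≤ (1 + μ) * (c / 2) * ‖y t‖ ^ 2 := by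
    rw [div_mul_eq_mul_div, div_le_iff₀ hk]
    calc (1 + μ) * (c / 2) * lyapunov g μ L H V (y t)
        ≤ (1 + μ) * (c / 2) * (k * ‖y t‖ ^ 2) := by
          gcongr
          exact hupper _
      _ = _ := by ring
  linarith

end ViscousSaintVenant

end

theorem proposition3 (g κ L H₀ V₀ b₀ b₁ c₁ : ℝ)
    (hg : 0 < g) (hκ : 0 < κ) (hL : 0 < L) (hH₀ : 0 < H₀) (hV₀ : 0 < V₀)
    (hsub : V₀ ^ 2 < g * H₀) (hsteady : g * H₀ < (2 + √2) * V₀ ^ 2) :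
    ∃ μ₀ : ℝ, 0 < μ₀ ∧ ∀ μ : ℝ, 0 < μ → μ < μ₀ → ∀ H V : ℝ → ℝ,
      ViscousSaintVenant.IsSteadyState g κ μ L H₀ V₀ H V →
      ((∃ k₁ k₂ : ℝ, 0 < k₁ ∧ 0 < k₂ ∧ ∀ y : ViscousSaintVenant.L2 L,
          k₁ * ‖y‖ ^ 2 ≤ ViscousSaintVenant.lyapunov g μ L H V y ∧
          ViscousSaintVenant.lyapunov g μ L H V y ≤ k₂ * ‖y‖ ^ 2) ∧
        (∀ y : ViscousSaintVenant.L2 L, y ≠ 0 → 0 < ViscousSaintVenant.lyapunov g μ L H V y) ∧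
        ViscousSaintVenant.lyapunov g μ L H V 0 = 0 ∧
        Filter.Tendsto (ViscousSaintVenant.lyapunov g μ L H V)
          (Bornology.cobounded (ViscousSaintVenant.L2 L)) Filter.atTop) ∧
      (ViscousSaintVenant.BoundaryCondition g L b₀ b₁ c₁ H V →
        ∃ γ : ℝ, 0 < γ ∧ ∀ y : ℝ → ViscousSaintVenant.L2 L,
          ViscousSaintVenant.IsSolution g κ μ L b₀ b₁ c₁ H V y →
          ∀ t : ℝ, 0 ≤ t → ∃ W' : ℝ,
            HasDerivWithinAt (fun s => ViscousSaintVenant.lyapunov g μ L H V (y s)) W'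
              (Set.Ici 0) t ∧
            W' ≤ -γ * ViscousSaintVenant.lyapunov g μ L H V (y t)) := by
  open ViscousSaintVenant in
  obtain ⟨V₁, H₁, K, c, hV₁, hH₁, hK, hc, hunif⟩ :=
    exists_uniform_bounds hg hκ hL hH₀ hV₀ hsub hsteady
  -- The largest `e` allowed by the two budgets `he₁` and `he₂`; the trace coefficient used below is
  -- `e * μ`.
  set e := min (c / (2 * (1 + L))) (8 * H₁ / L)
  have he : 0 < e := lt_min (by positivity) (by positivity)
  have he₁ : e * (1 + L) ≤ c / 2 := by
    have : e ≤ c / (2 * (1 + L)) := min_le_left _ _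
    rw [le_div_iff₀ (by positivity)] at this
    linarith
  have he₂ : e * L ≤ 8 * H₁ := by
    have : e ≤ 8 * H₁ / L := min_le_right _ _
    rwa [le_div_iff₀ hL] at this
  obtain ⟨μ₀, hμ₀, hsmall⟩ := mem_nhdsGT_iff_exists_Ioo_subset.1
    (hunif.and (eventually_outflow_nonneg b₁ c₁ hg hL hH₀ hV₀ hV₁ hH₁ hK he))
  refine ⟨μ₀, hμ₀, fun μ hμ hμlt H V hs => ?_⟩
  obtain ⟨hb, hout⟩ := hsmall ⟨hμ, hμlt⟩
  have hb := hb H V hs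
  obtain ⟨⟨B, hBy, hB⟩, hint, hequiv⟩ := lyapunov_properties hg hμ hH₁
    (hs.contDiffOn_weight hL).continuousOn hs.contDiff_H.continuousOn
    (fun x hx => ⟨(hb x hx).2.2.1, (hb x hx).2.2.2.1, (hb x hx).2.2.2.2.1, (hb x hx).2.2.2.2.2.1⟩)
  have hk₁ : 0 < (1 + μ) * min (g / 2) H₁ := mul_pos (by linarith) (lt_min (by linarith) hH₁)
  have hk₂ : 0 < (1 + μ) * max g H₀ := mul_pos (by linarith) (lt_max_of_lt_left hg)
  refine ⟨⟨⟨_, _, hk₁, hk₂, hequiv⟩, fun y hy => ?_, ?_, ?_⟩, fun hbc => ?_⟩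
  · have : 0 < ‖y‖ := norm_pos_iff.2 hy
    exact lt_of_lt_of_le (by positivity) (hequiv y).1
  · rw [hBy, map_zero]
  · refine Filter.tendsto_atTop_mono (fun y => (hequiv y).1) ?_
    exact ((Filter.tendsto_pow_atTop two_ne_zero).comp tendsto_norm_cobounded_atTop
      ).const_mul_atTop hk₁
  · have hLI : L ∈ Set.Icc 0 L := ⟨hL.le, le_rfl⟩
    obtain ⟨p1, p2, p3, p4, -, p6, p7, -⟩ := hb L hLI
    -- The half `c μ / 2` of the interior decay left by the trace term, divided by the upper
    -- constant in the norm equivalence.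
    refine ⟨(1 + μ) * (c * μ / 2) / ((1 + μ) * max g H₀), by positivity, fun y hy t ht => ?_⟩
    exact lyapunov_decay (e := e * μ) hs hg hL hμ (by positivity)
      (by linarith [mul_le_mul_of_nonneg_right he₁ hμ.le])
      (by linarith [mul_le_mul_of_nonneg_right he₂ hμ.le])
      (by positivity) hk₂ (fun x hx => (hb x hx).2.2.1)
      (fun x hx => (hb x hx).2.2.2.2.2.2.2) hbc
      (fun h v vx hv => hout H V h v vx b₀ p3 p4 p1 p2 (hs.subcritical L hLI) p6 p7 hbc hv)
      hBy hB hint (fun y => (hequiv y).2) hy ht
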